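/- Let $f:\mathbb{C}\to\hat{\mathbb{C}}=\mathbb{C}\cup\{\infty\}$ be a transcendental (i.e. non-rational) meromorphic function; entire functions are allowed. The iterate $f^n$ is defined at $z\in\mathbb{C}$ if none of $z,f(z),\dots,f^{n-1}(z)$ equals $\infty$, and for $D\subset\hat{\mathbb{C}}$, $f^{-n}(D)$ is the set of $z$ at which $f^n$ is defined with $f^n(z)\in D$. The Fatou set $F(f)$ is the set of $z\in\mathbb{C}$ having a neighbourhood on which all iterates $f^k$, $k\ge 1$, are defined and form a normal family (with respect to the spherical metric), and $J(f)=\mathbb{C}\setminus F(f)$. Let $\mathbb{D}(a,\delta)$ be the open Euclidean disk, and $D_{sph}(a,\delta)$ the open disk in $\hat{\mathbb{C}}$ for the spherical metric $|dz|/(1+|z|^2)$. * A hyperbolic set is a compact set $K\subset\mathbb{C}$ with $f(K)\subset K$ on which $f$ is expanding: there are $c>0$ and $\gamma>1$ with $|(f^n)'(z)|\ge c\gamma^n$ for all $n\ge 1$ and $z\in K$. The hyperbolic dimension is $\mathrm{HD}_{hyp}(f)=\sup_K \mathrm{HD}(K)$, the supremum over all hyperbolic sets $K$, where $\mathrm{HD}$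 is Hausdorff dimension. * The radial Julia set $J_r(f)$ is the set of $z\in J(f)$ for which there exist $\delta>0$ and an unbounded sequence $(n_j)$ of positive integers such that all $f^{n_j}(z)$ are defined and finite, the sequence $(|f^{n_j}(z)|)_j$ is bounded, and for every $j$ the map $f^{n_j}:U_j\to\mathbb{D}(f^{n_j}(z),\delta)$ is conformal (a holomorphic bijection), where $U_j$ is the connected component of $f^{-n_j}(\mathbb{D}(f^{n_j}(z),\delta))$ containing $z$. * The spherical radial Julia set $J_r^{sph}(f)$ is the set of $z\in J(f)$ for which there exist $\delta>0$ and an unbounded sequence $(n_j)$ of positive integers such that for every $j$ the iterate $f^{n_j}$ is defined at $z$ and $f^{n_j}:U_j\to D_{sph}(f^{n_j}(z),\delta)$ is conformal, where $U_j$ is the connected component of $f^{-n_j}(D_{sph}(f^{n_j}(z),\delta))$ containing $z$. Then $$\mathrm{HD}_{hyp}(f)=\mathrm{HD}(J_r(f))=\mathrm{HD}(J_r^{sph}(f)).$$ -/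

import Mathlib

open Set Filter Topology
open scoped OnePoint

namespace MeromorphicDynamics

noncomputable section

/-! The Riemann sphere is `OnePoint ℂ`. -/

/-- The chordal distance on the Riemann sphere, for the sphere of diameter one. -/
def chordalDist : OnePoint ℂ → OnePoint ℂ → ℝ
  | OnePoint.infty, OnePoint.infty => 0
  | OnePoint.infty, OnePoint.some w => 1 / Real.sqrt (1 + ‖w‖ ^ 2)
  | OnePoint.some z, OnePoint.infty => 1 / Real.sqrt (1 + ‖z‖ ^ 2)
  | OnePoint.some z, OnePoint.some w =>
      ‖z - w‖ / (Real.sqrt (1 + ‖z‖ ^ 2) * Real.sqrt (1 + ‖w‖ ^ 2))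

/-- The distance of the spherical metric `|dz| / (1 + |z|²)`. Its geodesics are arcs of great
circles on the sphere of diameter one, so it is the arcsine of the chordal distance; for instance
the distance from `0` to `z` is `arctan |z|`. -/
def sphDist (z w : OnePoint ℂ) : ℝ := Real.arcsin (chordalDist z w)

/-- The open spherical disk `D_sph(a, r)`. -/
def sphDisk (a : OnePoint ℂ) (r : ℝ) : Set (OnePoint ℂ) := {w | sphDist w a < r}

/-- The open Euclidean disk `D(a, r) ⊆ ℂ`, as a subset of the Riemann sphere. -/
def euclDisk (a : ℂ) (r : ℝ) : Set (OnePoint ℂ) := (fun w : ℂ => (w : OnePoint ℂ)) '' Metric.ball a r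

/-- `f : ℂ → ℂ ∪ {∞}` is a meromorphic function, with the value `∞` exactly at its poles:
it is the continuous sphere-valued extension of a meromorphic function in the sense of Mathlib
(whose values on a discrete set carry no information). The constant `∞` is not meromorphic. -/
def IsMeromorphic (f : ℂ → OnePoint ℂ) : Prop :=
  ∃ g : ℂ → ℂ, Meromorphic g ∧
    ∀ z, Tendsto (fun w => (g w : OnePoint ℂ)) (𝓝[≠] z) (𝓝 (f z))

/-- `f` is a rational function (constants and polynomials included). -/
def IsRational (f : ℂ → OnePoint ℂ) : Prop :=
  ∃ p q : Polynomial ℂ, q ≠ 0 ∧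
    ∀ z, q.eval z ≠ 0 → f z = ((p.eval z / q.eval z : ℂ) : OnePoint ℂ)

/-- A transcendental meromorphic function on the plane (entire functions included). -/
def IsTranscendentalMeromorphic (f : ℂ → OnePoint ℂ) : Prop :=
  IsMeromorphic f ∧ ¬ IsRational f

/-- Auxiliary total extension of `f` to the sphere, with the dummy value `∞` at `∞`. -/
def extend (f : ℂ → OnePoint ℂ) (w : OnePoint ℂ) : OnePoint ℂ := w.elim ∞ f

/-- The value `f^n(z)`; meaningful for `z ∈ iterDomain f n`. Once an orbit has hit `∞`, the
values remain at the dummy value `∞`. -/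
def iter (f : ℂ → OnePoint ℂ) (n : ℕ) (z : ℂ) : OnePoint ℂ := (extend f)^[n] (z : OnePoint ℂ)

/-- The set of points at which `f^n` is defined: none of `z, f(z), …, f^(n-1)(z)` is `∞`
(the value `f^n(z)` itself may be `∞`). -/
def iterDomain (f : ℂ → OnePoint ℂ) (n : ℕ) : Set ℂ := {z | ∀ j < n, iter f j z ≠ ∞}

/-- The full preimage `f^{-n}(D)`. -/
def iterPreimage (f : ℂ → OnePoint ℂ) (n : ℕ) (D : Set (OnePoint ℂ)) : Set ℂ :=
  {z | z ∈ iterDomain f n ∧ iter f n z ∈ D}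

/-- The family of all iterates `f^k`, `k ≥ 1`, is normal on `U`: every sequence in the family has a
subsequence that converges, uniformly on compact subsets of `U` with respect to the spherical
metric, to some sphere-valued function. -/
def IteratesNormalOn (f : ℂ → OnePoint ℂ) (U : Set ℂ) : Prop :=
  ∀ k : ℕ → ℕ, (∀ i, 1 ≤ k i) →
    ∃ φ : ℕ → ℕ, StrictMono φ ∧ ∃ g : ℂ → OnePoint ℂ,
      ∀ C ⊆ U, IsCompact C → ∀ ε : ℝ, 0 < ε →
        ∀ᶠ i in atTop, ∀ z ∈ C, sphDist (iter f (k (φ i)) z) (g z) < ε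

/-- The Fatou set: the points with a neighbourhood on which all iterates are defined and form a
normal family. -/
def fatouSet (f : ℂ → OnePoint ℂ) : Set ℂ :=
  {z | ∃ U : Set ℂ, IsOpen U ∧ z ∈ U ∧ (∀ k ≥ 1, U ⊆ iterDomain f k) ∧ IteratesNormalOn f U}

/-- The Julia set `J(f)`, as a subset of the plane. -/
def juliaSet (f : ℂ → OnePoint ℂ) : Set ℂ := (fatouSet f)ᶜ

/-- `f^n` is defined at `z`, and it maps `U` conformally onto `D`, where `U` is the connected
component of `f^{-n}(D)` that contains `z`. As `f^n` is holomorphic on its domain, it is conformal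
from `U` onto `D` if and only if it is a bijection from `U` onto `D`. -/
def PullsBackConformally (f : ℂ → OnePoint ℂ) (n : ℕ) (z : ℂ) (D : Set (OnePoint ℂ)) : Prop :=
  z ∈ iterPreimage f n D ∧ BijOn (iter f n) (connectedComponentIn (iterPreimage f n D) z) D

/-- The (Euclidean) radial Julia set `J_r(f)`. Here `w j` is the point `f^(n j)(z)` of the plane. -/
def radialJuliaSet (f : ℂ → OnePoint ℂ) : Set ℂ :=
  {z | z ∈ juliaSet f ∧ ∃ δ : ℝ, 0 < δ ∧ ∃ (n : ℕ → ℕ) (w : ℕ → ℂ),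
    (∀ j, 0 < n j) ∧ ¬ BddAbove (range n) ∧
    (∀ j, z ∈ iterDomain f (n j) ∧ iter f (n j) z = (w j : OnePoint ℂ)) ∧
    BddAbove (range fun j => ‖w j‖) ∧
    ∀ j, PullsBackConformally f (n j) z (euclDisk (w j) δ)}

/-- The spherical radial Julia set `J_r^sph(f)`. -/
def sphRadialJuliaSet (f : ℂ → OnePoint ℂ) : Set ℂ :=
  {z | z ∈ juliaSet f ∧ ∃ δ : ℝ, 0 < δ ∧ ∃ n : ℕ → ℕ,
    (∀ j, 0 < n j) ∧ ¬ BddAbove (range n) ∧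
    ∀ j, PullsBackConformally f (n j) z (sphDisk (iter f (n j) z) δ)}

/-- The derivative `(f^n)'(z)`, for a point `z` at which `f^n` is defined with a finite value
(near `z` the iterate `f^n` is then complex-valued, and the dummy value `0` at `∞` is not used). -/
def iterDeriv (f : ℂ → OnePoint ℂ) (n : ℕ) (z : ℂ) : ℂ :=
  deriv (fun w => (iter f n w).elim 0 id) z

/-- A hyperbolic set: a compact `K ⊆ ℂ` with `f(K) ⊆ K` such that `f|_K` is expanding. -/
structure IsHyperbolicSet (f : ℂ → OnePoint ℂ) (K : Set ℂ) : Prop where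
  isCompact : IsCompact K
  forwardInvariant : ∀ z ∈ K, ∃ w ∈ K, f z = (w : OnePoint ℂ)
  expanding : ∃ c : ℝ, 0 < c ∧ ∃ γ : ℝ, 1 < γ ∧ ∀ n ≥ 1, ∀ z ∈ K, c * γ ^ n ≤ ‖iterDeriv f n z‖

/-- The hyperbolic dimension: the supremum of the Hausdorff dimensions of all hyperbolic sets. -/
def hyperbolicDim (f : ℂ → OnePoint ℂ) : ENNReal :=
  ⨆ (K : Set ℂ) (_ : IsHyperbolicSet f K), dimH K

end

end MeromorphicDynamics

/-!
The three dimensions are compared along the chain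
`hyperbolicDim f ≤ dimH (radialJuliaSet f) ≤ dimH (sphRadialJuliaSet f) ≤ hyperbolicDim f`.

For the first two inequalities there are inclusions. On a hyperbolic set `K` some iterate is
injective and expanding on disks of a uniform radius, so that all its powers have inverse branches
on disks of that radius; and `K` lies in the Julia set, since the derivatives of the iterates grow
along bounded orbits (`IsHyperbolicSet.subset_radialJuliaSet`). At bounded places, Euclidean disks
contain spherical disks of comparable size, and conformal pull-backs restrict to smaller disks
(`radialJuliaSet_subset_sphRadialJuliaSet`).

For the last inequality, let `z` be a point of the spherical radial Julia set, and let `w` be a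
cluster point on the sphere of the images `f^n(z)` at the times `n` with a conformal pull-back. In a
coordinate of the sphere near `w`, infinitely many inverse branches are univalent on one disk, and
their distortion is bounded. They shrink to `z`: otherwise all iterates would be univalent on a disk
about `z`, and such a disk lies in the Fatou set because `f` is not injective on the plane
(`IsTranscendentalMeromorphic.mem_fatouSet_of_injOn`; this is the only place where it matters that
`f` is transcendental). Hence some iterate maps `z` into a disk `D(a, s)` such that images of
`D(a, s)` under inverse branches of bounded distortion approach the image of `z`, at distances
comparable to their sizes; countably many such disks and bounds suffice
(`IsTranscendentalMeromorphic.exists_iter_mem_branchSet`). As iterates preserve dimension away from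
critical points, it remains to bound the dimension of this set of points inside a single disk
`D(a, s)`. If it exceeds `d`, Vitali's covering lemma gives finitely many inverse branches from
`D(a, s)` into disjoint disks inside it whose contraction ratios satisfy `∑ (l i) ^ d ≥ 1`. Their
limit set has dimension at least `d` and lies in a hyperbolic set
(`dimH_branchSet_inter_ball_le`).

The distortion estimates are Koebe's, with non-sharp constants. They are derived from Bloch's
theorem, applied to a logarithm of `h - w` for a univalent function `h` that omits the value `w`
(`mul_norm_deriv_le_of_notMem_image`).
-/

namespace MeromorphicDynamics

open Metric

/-! ### Injective holomorphic functions and their inverses -/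

theorem nhds_le_map_nhds_of_injOn {G : ℂ → ℂ} {W : Set ℂ} (hW : IsOpen W)
    (hG : DifferentiableOn ℂ G W) (hinj : InjOn G W) {x : ℂ} (hx : x ∈ W) :
    𝓝 (G x) ≤ map G (𝓝 x) := by
  rcases (hG.analyticAt (hW.mem_nhds hx)).eventually_constant_or_nhds_le_map_nhds with h | h
  · exfalso
    have h2 : ∀ᶠ y in 𝓝[≠] x, y = x := by
      filter_upwards [nhdsWithin_le_nhds h, nhdsWithin_le_nhds (hW.mem_nhds hx)] with y hy hyW
      exact hinj hyW hx hy
    have h3 : ∀ᶠ y in 𝓝[≠] x, False := by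
      filter_upwards [h2, self_mem_nhdsWithin] with y hy hy' using hy' hy
    simp at h3
    exact (NeBot.ne inferInstance) h3
  · exact h

theorem isOpen_image_of_injOn {G : ℂ → ℂ} {W : Set ℂ} (hW : IsOpen W)
    (hG : DifferentiableOn ℂ G W) (hinj : InjOn G W) : IsOpen (G '' W) := by
  rw [isOpen_iff_mem_nhds]
  rintro _ ⟨x, hx, rfl⟩
  exact nhds_le_map_nhds_of_injOn hW hG hinj hx (image_mem_map (hW.mem_nhds hx))

theorem continuousAt_of_leftInvOn {G φ : ℂ → ℂ} {W : Set ℂ} (hW : IsOpen W)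
    (hG : DifferentiableOn ℂ G W) (hinv : LeftInvOn φ G W) {x : ℂ} (hx : x ∈ W) :
    ContinuousAt φ (G x) := by
  have hle := nhds_le_map_nhds_of_injOn hW hG hinv.injOn hx
  intro s hs
  rw [hinv hx] at hs
  refine mem_map.2 (mem_of_superset (hle (image_mem_map (inter_mem hs (hW.mem_nhds hx)))) ?_)
  rintro _ ⟨t, ⟨hts, htW⟩, rfl⟩
  simpa [hinv htW] using hts

/-- The inverse of an injective holomorphic function is holomorphic: it is continuous, and
differentiable off the isolated critical values, which are therefore removable. -/
theorem differentiableAt_of_leftInvOn {G φ : ℂ → ℂ} {W : Set ℂ} (hW : IsOpen W)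
    (hG : DifferentiableOn ℂ G W) (hinv : LeftInvOn φ G W) {x : ℂ} (hx : x ∈ W) :
    DifferentiableAt ℂ φ (G x) := by
  have hGx := hG.analyticAt (hW.mem_nhds hx)
  have hcont := continuousAt_of_leftInvOn hW hG hinv hx
  have himg : G '' W ∈ 𝓝 (G x) :=
    (isOpen_image_of_injOn hW hG hinv.injOn).mem_nhds (mem_image_of_mem _ hx)
  have hne : ∀ᶠ y in 𝓝[≠] x, deriv G y ≠ 0 := by
    rcases hGx.deriv.eventually_eq_zero_or_eventually_ne_zero with h | h
    · exfalso
      obtain ⟨ε, hε, hb⟩ := Metric.mem_nhds_iff.1 (inter_mem h (hW.mem_nhds hx))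
      have hconst : ∀ y ∈ ball x ε, G y = G x := fun y hy =>
        isOpen_ball.is_const_of_deriv_eq_zero (convex_ball x ε).isPreconnected
          (hG.mono fun y hy => (hb hy).2) (fun y hy => (hb hy).1) hy (mem_ball_self hε)
      have h3 : ∀ᶠ y in 𝓝[≠] x, False := by
        filter_upwards [nhdsWithin_le_nhds (ball_mem_nhds x hε), self_mem_nhdsWithin] with y hy hy'
        exact hy' (hinv.injOn (hb hy).2 hx (hconst y hy))
      simp at h3
      exact (NeBot.ne inferInstance) h3
    · exact h
  refine (Complex.analyticAt_of_differentiable_on_punctured_nhds_of_continuousAt ?_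
    hcont).differentiableAt
  have hφ : Tendsto φ (𝓝[≠] (G x)) (𝓝[≠] x) := by
    refine tendsto_nhdsWithin_iff.2 ⟨?_, ?_⟩
    · have := hcont.tendsto.mono_left (nhdsWithin_le_nhds (s := {G x}ᶜ))
      rwa [hinv hx] at this
    · filter_upwards [nhdsWithin_le_nhds himg, self_mem_nhdsWithin]
      rintro _ ⟨t, ht, rfl⟩ hne' heq
      apply hne'
      rw [hinv ht] at heq
      simp [show t = x from heq]
  filter_upwards [hφ.eventually hne, nhdsWithin_le_nhds himg]
  rintro _ hd ⟨t, ht, rfl⟩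
  refine (HasDerivAt.of_local_left_inverse (f := G) (continuousAt_of_leftInvOn hW hG hinv ht)
    (f' := deriv G (φ (G t))) ?_ hd ?_).differentiableAt
  · rw [hinv ht]
    exact (hG.differentiableAt (hW.mem_nhds ht)).hasDerivAt
  · filter_upwards [(isOpen_image_of_injOn hW hG hinv.injOn).mem_nhds (mem_image_of_mem _ ht)]
    rintro _ ⟨u, hu, rfl⟩
    rw [hinv hu]

theorem deriv_mul_deriv_eq_one_of_leftInvOn {G φ : ℂ → ℂ} {W : Set ℂ} (hW : IsOpen W)
    (hG : DifferentiableOn ℂ G W) (hinv : LeftInvOn φ G W) {x : ℂ} (hx : x ∈ W) :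
    deriv φ (G x) * deriv G x = 1 := by
  have h1 := (differentiableAt_of_leftInvOn hW hG hinv hx).hasDerivAt.comp x
    (hG.differentiableAt (hW.mem_nhds hx)).hasDerivAt
  have h2 : HasDerivAt (φ ∘ G) 1 x := by
    refine (hasDerivAt_id x).congr_of_eventuallyEq ?_
    filter_upwards [hW.mem_nhds hx] with y hy using hinv hy
  exact h1.unique h2

theorem deriv_ne_zero_of_injOn {G : ℂ → ℂ} {W : Set ℂ} (hW : IsOpen W)
    (hG : DifferentiableOn ℂ G W) (hinj : InjOn G W) {x : ℂ} (hx : x ∈ W) : deriv G x ≠ 0 :=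
  right_ne_zero_of_mul
    (deriv_mul_deriv_eq_one_of_leftInvOn hW hG hinj.leftInvOn_invFunOn hx ▸ one_ne_zero)

/-! ### Distortion of univalent functions -/

theorem norm_image_sub_sub_mul_le {G : ℂ → ℂ} {s : Set ℂ} {c : ℂ} {K : ℝ} (hs : Convex ℝ s)
    (hd : ∀ x ∈ s, DifferentiableAt ℂ G x) (hb : ∀ x ∈ s, ‖deriv G x - c‖ ≤ K) {x y : ℂ}
    (hx : x ∈ s) (hy : y ∈ s) : ‖G x - G y - c * (x - y)‖ ≤ K * ‖x - y‖ := by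
  have h := hs.norm_image_sub_le_of_norm_hasDerivWithin_le
    (f := fun x => G x - c * x) (f' := fun x => deriv G x - c * 1)
    (fun t ht => ((hd t ht).hasDerivAt.sub ((hasDerivAt_id t).const_mul c)).hasDerivWithinAt)
    (fun t ht => by rw [mul_one]; exact hb t ht) hy hx
  rwa [show G x - G y - c * (x - y) = G x - c * x - (G y - c * y) by ring]

theorem mul_norm_sub_le_norm_image_sub {G : ℂ → ℂ} {s : Set ℂ} {c : ℂ} {K : ℝ} (hs : Convex ℝ s)
    (hd : ∀ x ∈ s, DifferentiableAt ℂ G x) (hb : ∀ x ∈ s, ‖deriv G x - c‖ ≤ K) {x y : ℂ}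
    (hx : x ∈ s) (hy : y ∈ s) : (‖c‖ - K) * ‖x - y‖ ≤ ‖G x - G y‖ := by
  have h1 := norm_image_sub_sub_mul_le hs hd hb hx hy
  have h2 := norm_sub_norm_le (c * (x - y)) (G x - G y)
  rw [norm_sub_rev (c * (x - y)), norm_mul] at h2
  linarith

theorem ball_subset_image_closedBall_of_le {h : ℂ → ℂ} {b : ℂ} {t m : ℝ} (ht : 0 < t) (hm : 0 < m)
    (hd : DifferentiableOn ℂ h (closedBall b t))
    (hlow : ∀ x ∈ closedBall b t, m * ‖x - b‖ ≤ ‖h x - h b‖) :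
    ball (h b) (m * t / 2) ⊆ h '' closedBall b t := by
  refine DiffContOnCl.ball_subset_image_closedBall ?_ ht (fun x hx => ?_) ?_
  · refine DifferentiableOn.diffContOnCl ?_
    rwa [closure_ball _ ht.ne']
  · have := hlow x (sphere_subset_closedBall hx)
    rwa [mem_sphere_iff_norm.1 hx] at this
  · refine Filter.Eventually.frequently (f := 𝓝[≠] b) ?_ |>.filter_mono nhdsWithin_le_nhds
    filter_upwards [nhdsWithin_le_nhds (closedBall_mem_nhds b ht), self_mem_nhdsWithin]
      with x hx hxb heq
    have h1 := hlow x hx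
    rw [heq, sub_self, norm_zero] at h1
    exact absurd h1 (not_le.2 (mul_pos hm (norm_pos_iff.2 (sub_ne_zero.2 hxb))))

/-- Bloch's theorem: the image of a disk of radius `r` under a holomorphic function `h` contains
a disk whose radius is at least `r * ‖h' a‖ / 128`, where `a` is the centre. -/
theorem exists_ball_subset_image {h : ℂ → ℂ} {a : ℂ} {r : ℝ} (hr : 0 < r)
    (hd : DifferentiableOn ℂ h (ball a r)) :
    ∃ b, ball b (r * ‖deriv h a‖ / 128) ⊆ h '' ball a r := by
  rcases eq_or_ne (deriv h a) 0 with h0 | h0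
  · exact ⟨0, by simp [h0]⟩
  have h0' : 0 < ‖deriv h a‖ := norm_pos_iff.2 h0
  set ρ := r / 2 with hρ
  have hsub : closedBall a ρ ⊆ ball a r := closedBall_subset_ball (by linarith)
  have hcd : ContinuousOn (deriv h) (ball a r) := (hd.deriv isOpen_ball).continuousOn
  have hM : ContinuousOn (fun x => (ρ - dist x a) * ‖deriv h x‖) (closedBall a ρ) :=
    (Continuous.continuousOn (by fun_prop)).mul (hcd.mono hsub).norm
  -- `b` maximises the distance to the boundary weighted by `‖h'‖`.
  obtain ⟨b, hb, hmax⟩ := (isCompact_closedBall a ρ).exists_isMaxOn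
    ⟨a, mem_closedBall_self (by linarith)⟩ hM
  have hmax' : ∀ x ∈ closedBall a ρ,
      (ρ - dist x a) * ‖deriv h x‖ ≤ (ρ - dist b a) * ‖deriv h b‖ := fun x hx => hmax hx
  have ha := hmax' a (mem_closedBall_self (by linarith))
  rw [dist_self, sub_zero] at ha
  have hpos : 0 < (ρ - dist b a) * ‖deriv h b‖ := lt_of_lt_of_le (by positivity) ha
  set t := (ρ - dist b a) / 2 with ht
  have hba : dist b a ≤ ρ := hb
  have ht0 : 0 < t := by
    rcases lt_or_eq_of_le hba with h | h
    · simp only [ht]; linarith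
    · rw [h] at hpos; simp at hpos
  have hdb : 0 < ‖deriv h b‖ := by
    by_contra hcon
    have : ‖deriv h b‖ = 0 := le_antisymm (not_lt.1 hcon) (norm_nonneg _)
    rw [this] at hpos; simp at hpos
  have hbt : ball b t ⊆ closedBall a ρ := by
    intro x hx
    have := dist_triangle x b a
    rw [mem_ball] at hx
    rw [mem_closedBall]; linarith
  have hbound : ∀ x ∈ ball b t, ‖deriv h x‖ ≤ 2 * ‖deriv h b‖ := by
    intro x hx
    have h1 := hmax' x (hbt hx)
    have h2 : t ≤ ρ - dist x a := by
      have := dist_triangle x b a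
      rw [mem_ball] at hx
      linarith
    have h3 : t * ‖deriv h x‖ ≤ t * (2 * ‖deriv h b‖) := by
      calc t * ‖deriv h x‖ ≤ (ρ - dist x a) * ‖deriv h x‖ := by gcongr
        _ ≤ _ := h1
        _ = t * (2 * ‖deriv h b‖) := by rw [ht]; ring
    exact le_of_mul_le_mul_left h3 ht0
  have hschwarz : ∀ x ∈ ball b t, ‖deriv h x - deriv h b‖ ≤ 3 * ‖deriv h b‖ / t * dist x b := by
    intro x hx
    rw [← dist_eq_norm]
    refine Complex.dist_le_div_mul_dist_of_mapsTo_ball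
      ((hd.deriv isOpen_ball).mono (hbt.trans hsub)) ?_ hx
    intro y hy
    rw [mem_closedBall, dist_eq_norm]
    calc ‖deriv h y - deriv h b‖ ≤ ‖deriv h y‖ + ‖deriv h b‖ := norm_sub_le _ _
      _ ≤ _ := by linarith [hbound y hy]
  have hsmall : closedBall b (t / 8) ⊆ ball b t := closedBall_subset_ball (by linarith)
  have hclose : ∀ x ∈ closedBall b (t / 8), ‖deriv h x - deriv h b‖ ≤ ‖deriv h b‖ / 2 := by
    intro x hx
    refine (hschwarz x (hsmall hx)).trans ?_
    have hx' : dist x b ≤ t / 8 := hx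
    calc 3 * ‖deriv h b‖ / t * dist x b ≤ 3 * ‖deriv h b‖ / t * (t / 8) := by gcongr
      _ = 3 / 8 * ‖deriv h b‖ := by field_simp
      _ ≤ _ := by linarith
  have hdc : DifferentiableOn ℂ h (closedBall b (t / 8)) :=
    hd.mono (hsmall.trans (hbt.trans hsub))
  have hopen := ball_subset_image_closedBall_of_le (m := ‖deriv h b‖ / 2) (by positivity)
    (by positivity) hdc fun x hx => by
      have := mul_norm_sub_le_norm_image_sub (convex_closedBall b (t / 8)) (fun y hy =>
        hd.differentiableAt (isOpen_ball.mem_nhds (hsub (hbt (hsmall hy))))) hclose hx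
        (mem_closedBall_self (by linarith))
      rwa [sub_half] at this
  refine ⟨h b, (ball_subset_ball ?_).trans (hopen.trans
    (image_mono (hsmall.trans (hbt.trans hsub))))⟩
  rw [hρ] at ha
  have : (ρ - dist b a) * ‖deriv h b‖ = 2 * (t * ‖deriv h b‖) := by rw [ht]; ring
  rw [this] at ha
  linarith

/-- A zero-free holomorphic function on a disk has a holomorphic logarithm. -/
theorem exists_log_on_ball {u : ℂ → ℂ} {a : ℂ} {r : ℝ} (hr : 0 < r)
    (hd : DifferentiableOn ℂ u (ball a r)) (hu : ∀ x ∈ ball a r, u x ≠ 0) :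
    ∃ L : ℂ → ℂ, (∀ x ∈ ball a r, HasDerivAt L (deriv u x / u x) x) ∧
      ∀ x ∈ ball a r, Complex.exp (L x) = u x := by
  have hdd : DifferentiableOn ℂ (fun x => deriv u x / u x) (ball a r) :=
    (hd.deriv isOpen_ball).div hd hu
  have ha : a ∈ ball a r := mem_ball_self hr
  obtain ⟨L, hLa, hL⟩ := hdd.isExactOn_ball.with_val_at a (Complex.log (u a))
  refine ⟨L, hL, fun x hx => ?_⟩
  have hE : ∀ x ∈ ball a r, HasDerivAt (fun x => Complex.exp (-L x) * u x) 0 x := by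
    intro x hx
    have h1 := ((hL x hx).neg.cexp).mul
      (hd.differentiableAt (isOpen_ball.mem_nhds hx)).hasDerivAt
    refine HasDerivAt.congr_deriv h1 ?_
    have h2 : deriv u x / u x * u x = deriv u x := div_mul_cancel₀ _ (hu x hx)
    simp only [Pi.neg_apply]
    linear_combination -Complex.exp (-L x) * h2
  have hc := isOpen_ball.is_const_of_deriv_eq_zero (convex_ball a r).isPreconnected
    (fun x hx => (hE x hx).differentiableAt.differentiableWithinAt)
    (fun x hx => (hE x hx).deriv) hx ha
  simp only [hLa] at hc
  rw [Complex.exp_neg, Complex.exp_neg, Complex.exp_log (hu a ha),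
    inv_mul_cancel₀ (hu a ha)] at hc
  field_simp at hc
  exact hc.symm

/-- The constant in the weak form of Koebe's one-quarter theorem below. -/
def koebeConst : ℝ := 1024

/-- A weak form of Koebe's one-quarter theorem: a univalent function `h` on a disk of radius `r`
with centre `a` omits no value at distance less than `r * ‖h' a‖ / koebeConst` from `h a`.
A logarithm of `h - w` is univalent, and its image contains no two points differing by `2πi`,
which limits the size of the disk that Bloch's theorem produces. -/
theorem mul_norm_deriv_le_of_notMem_image {h : ℂ → ℂ} {a w : ℂ} {r : ℝ} (hr : 0 < r)
    (hd : DifferentiableOn ℂ h (ball a r)) (hinj : InjOn h (ball a r))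
    (hw : w ∉ h '' ball a r) : r * ‖deriv h a‖ ≤ koebeConst * ‖h a - w‖ := by
  have ha : a ∈ ball a r := mem_ball_self hr
  have hu : ∀ x ∈ ball a r, h x - w ≠ 0 := fun x hx h0 => hw ⟨x, hx, sub_eq_zero.1 h0⟩
  obtain ⟨L, hL, hexp⟩ := exists_log_on_ball (u := fun x => h x - w) hr (hd.sub_const w) hu
  obtain ⟨b, hb⟩ := exists_ball_subset_image hr
    (fun x hx => (hL x hx).differentiableAt.differentiableWithinAt : DifferentiableOn ℂ L _)
  have hder : deriv L a = deriv h a / (h a - w) := by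
    rw [(hL a ha).deriv, deriv_sub_const]
  have hpos : 0 < ‖h a - w‖ := norm_pos_iff.2 (hu a ha)
  by_contra! hlt
  have hbig : 2 * Real.pi < r * ‖deriv L a‖ / 128 := by
    have hpi := Real.pi_lt_four
    have : koebeConst < r * ‖deriv L a‖ := by
      rw [hder, norm_div, mul_div_assoc', lt_div_iff₀ hpos]
      exact hlt
    rw [koebeConst] at this
    linarith
  have hp0 : (0 : ℝ) < 2 * Real.pi := by positivity
  obtain ⟨x, hx, hxb⟩ := hb (mem_ball_self (hp0.trans hbig))
  obtain ⟨y, hy, hyb⟩ := hb (show b + 2 * Real.pi * Complex.I ∈ _ by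
    rw [mem_ball, dist_eq_norm, add_sub_cancel_left, norm_mul, Complex.norm_I, mul_one]
    rw [show ((2 : ℂ) * Real.pi) = ((2 * Real.pi : ℝ) : ℂ) by push_cast; rfl,
      Complex.norm_real, Real.norm_of_nonneg hp0.le]
    exact hbig)
  have hexy : h x - w = h y - w := by
    rw [← hexp x hx, ← hexp y hy, hxb, hyb, Complex.exp_add, Complex.exp_two_pi_mul_I, mul_one]
  have hxy : x = y := hinj hx hy (sub_left_injective hexy)
  rw [← hxy, hxb] at hyb
  have : (2 : ℂ) * Real.pi * Complex.I = 0 := by linear_combination -hyb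
  simp [Real.pi_ne_zero] at this

theorem koebeConst_pos : 0 < koebeConst := by norm_num [koebeConst]

theorem ball_subset_image_of_injOn {h : ℂ → ℂ} {a : ℂ} {r : ℝ} (hr : 0 < r)
    (hd : DifferentiableOn ℂ h (ball a r)) (hinj : InjOn h (ball a r)) :
    ball (h a) (r * ‖deriv h a‖ / koebeConst) ⊆ h '' ball a r := by
  intro w hw
  by_contra hcon
  have h1 := mul_norm_deriv_le_of_notMem_image hr hd hinj hcon
  rw [mem_ball, dist_comm, dist_eq_norm, lt_div_iff₀ koebeConst_pos] at hw
  linarith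

/-- By Schwarz's lemma for the inverse, the image of a univalent function cannot be too large. -/
theorem exists_notMem_image_of_injOn {h : ℂ → ℂ} {a : ℂ} {r : ℝ} (hr : 0 < r)
    (hd : DifferentiableOn ℂ h (ball a r)) (hinj : InjOn h (ball a r)) :
    ∃ w, w ∉ h '' ball a r ∧ ‖h a - w‖ ≤ 2 * r * ‖deriv h a‖ := by
  by_contra! hcon
  have ha : a ∈ ball a r := mem_ball_self hr
  have hne := deriv_ne_zero_of_injOn isOpen_ball hd hinj ha
  have hnp : 0 < ‖deriv h a‖ := norm_pos_iff.2 hne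
  set S := 2 * r * ‖deriv h a‖ with hS
  have hS0 : 0 < S := by positivity
  have hsub : ball (h a) S ⊆ h '' ball a r := by
    intro w hw
    by_contra hw'
    have := hcon w hw'
    rw [mem_ball, dist_comm, dist_eq_norm] at hw
    linarith
  have hinv : LeftInvOn (Function.invFunOn h (ball a r)) h (ball a r) := hinj.leftInvOn_invFunOn
  set φ := Function.invFunOn h (ball a r)
  have h1 : ‖deriv φ (h a)‖ ≤ r / S := by
    refine Complex.norm_deriv_le_div_of_mapsTo_ball (fun w hw => ?_) (fun w hw => ?_) hS0
    · obtain ⟨x, hx, rfl⟩ := hsub hw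
      exact (differentiableAt_of_leftInvOn isOpen_ball hd hinv hx).differentiableWithinAt
    · obtain ⟨x, hx, rfl⟩ := hsub hw
      rw [hinv hx, hinv ha]
      exact ball_subset_closedBall hx
  have h2 := congrArg norm (deriv_mul_deriv_eq_one_of_leftInvOn isOpen_ball hd hinv ha)
  rw [norm_mul, norm_one] at h2
  have h3 : ‖deriv φ (h a)‖ * ‖deriv h a‖ ≤ r / S * ‖deriv h a‖ := by gcongr
  have h4 : r / S * ‖deriv h a‖ = 1 / 2 := by rw [hS]; field_simp
  linarith

/-- The constant of the distortion estimates below. -/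
noncomputable def distortionConst : ℝ := 4 * koebeConst * Real.exp koebeConst

theorem one_le_distortionConst : 1 ≤ distortionConst := by
  have := Real.add_one_le_exp koebeConst
  rw [distortionConst]
  norm_num [koebeConst] at *
  linarith

/-- Koebe's distortion theorem, with a non-sharp constant: the upper bound. If `h` omits `w`, the
logarithmic derivative of `h - w` is bounded by the weak one-quarter theorem. -/
theorem norm_deriv_le_of_injOn {h : ℂ → ℂ} {a : ℂ} {r : ℝ}
    (hd : DifferentiableOn ℂ h (ball a r)) (hinj : InjOn h (ball a r)) {x : ℂ}
    (hx : x ∈ ball a (r / 2)) : ‖deriv h x‖ ≤ distortionConst * ‖deriv h a‖ := by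
  have hr : 0 < r := by have := pos_of_mem_ball hx; linarith
  have ha : a ∈ ball a r := mem_ball_self hr
  obtain ⟨w, hw, hwr⟩ := exists_notMem_image_of_injOn hr hd hinj
  have hu : ∀ x ∈ ball a r, h x - w ≠ 0 := fun x hx h0 => hw ⟨x, hx, sub_eq_zero.1 h0⟩
  have hhalf : ball a (r / 2) ⊆ ball a r := ball_subset_ball (by linarith)
  have hquarter : ∀ y ∈ ball a (r / 2), ‖deriv h y‖ ≤ 2 * koebeConst / r * ‖h y - w‖ := by
    intro y hy
    have hsub : ball y (r / 2) ⊆ ball a r := ball_subset_ball' (by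
      rw [mem_ball] at hy; linarith)
    have := mul_norm_deriv_le_of_notMem_image (half_pos hr) (hd.mono hsub) (hinj.mono hsub)
      (fun hc => hw (image_mono hsub hc))
    calc ‖deriv h y‖ = r / 2 * ‖deriv h y‖ * (2 / r) := by field_simp
      _ ≤ koebeConst * ‖h y - w‖ * (2 / r) := by gcongr
      _ = _ := by ring
  obtain ⟨L, hL, hexp⟩ := exists_log_on_ball (u := fun x => h x - w) hr (hd.sub_const w) hu
  have hK := koebeConst_pos
  have hLx : ‖L x - L a‖ ≤ 2 * koebeConst / r * ‖x - a‖ := by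
    refine (convex_ball a (r / 2)).norm_image_sub_le_of_norm_hasDerivWithin_le
      (fun y hy => (hL y (hhalf hy)).hasDerivWithinAt) (fun y hy => ?_)
      (mem_ball_self (half_pos hr)) hx
    rw [norm_div, deriv_sub_const, div_le_iff₀ (norm_pos_iff.2 (hu y (hhalf hy)))]
    exact hquarter y hy
  have hLx' : ‖L x - L a‖ ≤ koebeConst := by
    refine hLx.trans ?_
    rw [mem_ball, dist_eq_norm] at hx
    calc 2 * koebeConst / r * ‖x - a‖ ≤ 2 * koebeConst / r * (r / 2) := by gcongr
      _ = koebeConst := by field_simp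
  have hux : ‖h x - w‖ ≤ ‖h a - w‖ * Real.exp koebeConst := by
    rw [← hexp x (hhalf hx), ← hexp a ha, Complex.norm_exp, Complex.norm_exp, ← Real.exp_add]
    refine Real.exp_le_exp.2 ?_
    have := (Complex.re_le_norm (L x - L a)).trans hLx'
    rw [Complex.sub_re] at this
    linarith
  calc ‖deriv h x‖ ≤ 2 * koebeConst / r * ‖h x - w‖ := hquarter x hx
    _ ≤ 2 * koebeConst / r * (2 * r * ‖deriv h a‖ * Real.exp koebeConst) := by
        gcongr
        exact hux.trans (by gcongr)
    _ = distortionConst * ‖deriv h a‖ := by rw [distortionConst]; field_simp; ring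

theorem norm_deriv_center_le_of_injOn {h : ℂ → ℂ} {a : ℂ} {r : ℝ}
    (hd : DifferentiableOn ℂ h (ball a r)) (hinj : InjOn h (ball a r)) {x : ℂ}
    (hx : x ∈ ball a (r / 4)) : ‖deriv h a‖ ≤ distortionConst * ‖deriv h x‖ := by
  have hx' := mem_ball.1 hx
  have hr := pos_of_mem_ball hx
  have hsub : ball x (3 * r / 4) ⊆ ball a r := ball_subset_ball' (by linarith)
  refine norm_deriv_le_of_injOn (hd.mono hsub) (hinj.mono hsub) ?_
  rw [mem_ball, dist_comm]
  linarith

theorem dist_le_of_injOn {h : ℂ → ℂ} {a : ℂ} {r : ℝ}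
    (hd : DifferentiableOn ℂ h (ball a r)) (hinj : InjOn h (ball a r)) {x y : ℂ}
    (hx : x ∈ ball a (r / 2)) (hy : y ∈ ball a (r / 2)) :
    dist (h x) (h y) ≤ distortionConst * ‖deriv h a‖ * dist x y := by
  have hr : 0 < r := by have := pos_of_mem_ball hx; linarith
  rw [dist_eq_norm, dist_eq_norm]
  exact (convex_ball a (r / 2)).norm_image_sub_le_of_norm_deriv_le
    (fun z hz => hd.differentiableAt (isOpen_ball.mem_nhds (ball_subset_ball (by linarith) hz)))
    (fun z hz => norm_deriv_le_of_injOn hd hinj hz) hy hx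

theorem le_dist_of_injOn {h : ℂ → ℂ} {a : ℂ} {r : ℝ}
    (hd : DifferentiableOn ℂ h (ball a r)) (hinj : InjOn h (ball a r)) {x y : ℂ}
    (hx : x ∈ ball a (r / 4)) (hy : y ∈ ball a (r / 4)) :
    ‖deriv h a‖ * dist x y ≤ koebeConst * distortionConst * dist (h x) (h y) := by
  rcases eq_or_ne x y with rfl | hxy
  · simp
  have hpos : 0 < dist x y := dist_pos.2 hxy
  have hx' := mem_ball.1 hx
  have hy' := mem_ball.1 hy
  have hsub : ball x (dist x y) ⊆ ball a r := ball_subset_ball' (by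
    have := dist_triangle_right x y a
    linarith)
  have hya : y ∈ ball a r := ball_subset_ball (by have := pos_of_mem_ball hx; linarith) hy
  have h1 := mul_norm_deriv_le_of_notMem_image hpos (hd.mono hsub) (hinj.mono hsub)
    (w := h y) (by
      rintro ⟨z, hz, hzy⟩
      have := hinj (hsub hz) hya hzy
      rw [this, mem_ball, dist_comm] at hz
      exact lt_irrefl _ hz)
  have h2 := norm_deriv_center_le_of_injOn hd hinj hx
  have h3 := one_le_distortionConst
  rw [← dist_eq_norm] at h1
  calc ‖deriv h a‖ * dist x y ≤ distortionConst * ‖deriv h x‖ * dist x y := by gcongr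
    _ = distortionConst * (dist x y * ‖deriv h x‖) := by ring
    _ ≤ distortionConst * (koebeConst * dist (h x) (h y)) := by gcongr
    _ = _ := by ring

/-- A holomorphic function is bi-Lipschitz near a point at which its derivative does not vanish. -/
theorem exists_ball_biLipschitz {G : ℂ → ℂ} {z : ℂ} (hG : AnalyticAt ℂ G z)
    (h0 : deriv G z ≠ 0) : ∃ r > 0, ∀ x ∈ ball z r, ∀ y ∈ ball z r,
      ‖deriv G z‖ / 2 * dist x y ≤ dist (G x) (G y) ∧
        dist (G x) (G y) ≤ 2 * ‖deriv G z‖ * dist x y := by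
  have hpos : 0 < ‖deriv G z‖ := norm_pos_iff.2 h0
  have hev : ∀ᶠ x in 𝓝 z, AnalyticAt ℂ G x ∧ ‖deriv G x - deriv G z‖ < ‖deriv G z‖ / 2 := by
    refine hG.eventually_analyticAt.and ?_
    have := hG.deriv.continuousAt.eventually (ball_mem_nhds _ (half_pos hpos))
    filter_upwards [this] with x hx
    rwa [dist_eq_norm] at hx
  obtain ⟨r, hr, hb⟩ := Metric.eventually_nhds_iff_ball.1 hev
  refine ⟨r, hr, fun x hx y hy => ?_⟩
  have hd : ∀ x ∈ ball z r, DifferentiableAt ℂ G x := fun x hx => (hb x hx).1.differentiableAt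
  have hb' : ∀ x ∈ ball z r, ‖deriv G x - deriv G z‖ ≤ ‖deriv G z‖ / 2 :=
    fun x hx => (hb x hx).2.le
  have h1 := mul_norm_sub_le_norm_image_sub (convex_ball z r) hd hb' hx hy
  have h2 := norm_image_sub_sub_mul_le (convex_ball z r) hd hb' hx hy
  have h3 := norm_sub_norm_le (G x - G y) (deriv G z * (x - y))
  rw [norm_mul] at h3
  rw [dist_eq_norm, dist_eq_norm]
  constructor
  · linarith
  · nlinarith [norm_nonneg (x - y)]

end MeromorphicDynamics

namespace MeromorphicDynamics

open Metric

/-! ### Holomorphic maps to the sphere and iterates -/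

/-- The complex value of a point of the sphere, with the dummy value `0` at `∞`. -/
def finitePart (w : OnePoint ℂ) : ℂ := w.elim 0 id

/-- The coordinate `1 / w` at `∞` on the sphere; its value at `0` is the dummy value `0`. -/
noncomputable def reciprocal (w : OnePoint ℂ) : ℂ := w.elim 0 (·⁻¹)

@[simp] theorem finitePart_coe (z : ℂ) : finitePart (z : OnePoint ℂ) = z := rfl

@[simp] theorem reciprocal_coe (z : ℂ) : reciprocal (z : OnePoint ℂ) = z⁻¹ := rfl

@[simp] theorem reciprocal_infty : reciprocal ∞ = 0 := rfl

theorem coe_finitePart {w : OnePoint ℂ} (hw : w ≠ ∞) : (finitePart w : OnePoint ℂ) = w := by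
  obtain ⟨z, rfl⟩ := OnePoint.ne_infty_iff_exists.1 hw
  rfl

theorem reciprocal_of_ne_infty {w : OnePoint ℂ} (hw : w ≠ ∞) :
    reciprocal w = (finitePart w)⁻¹ := by
  obtain ⟨z, rfl⟩ := OnePoint.ne_infty_iff_exists.1 hw
  rfl

theorem continuousAt_finitePart {w : OnePoint ℂ} (hw : w ≠ ∞) : ContinuousAt finitePart w := by
  obtain ⟨z, rfl⟩ := OnePoint.ne_infty_iff_exists.1 hw
  exact OnePoint.continuousAt_coe.2 continuousAt_id

theorem continuousAt_reciprocal_infty : ContinuousAt reciprocal ∞ := by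
  rw [OnePoint.continuousAt_infty', coclosedCompact_eq_cocompact, ← cobounded_eq_cocompact]
  exact tendsto_inv₀_cobounded

/-- A sphere-valued map is holomorphic at `z`, as seen in the coordinates `w` and `1 / w`. -/
structure HolomorphicAt (h : ℂ → OnePoint ℂ) (z : ℂ) : Prop where
  continuousAt : ContinuousAt h z
  analyticAt_finitePart : h z ≠ ∞ → AnalyticAt ℂ (finitePart ∘ h) z
  analyticAt_reciprocal : h z = ∞ → AnalyticAt ℂ (reciprocal ∘ h) z

theorem HolomorphicAt.congr {h k : ℂ → OnePoint ℂ} {z : ℂ} (hh : HolomorphicAt h z)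
    (heq : h =ᶠ[𝓝 z] k) : HolomorphicAt k z where
  continuousAt := hh.continuousAt.congr heq
  analyticAt_finitePart hk := (hh.analyticAt_finitePart (heq.eq_of_nhds ▸ hk)).congr
    (heq.fun_comp _)
  analyticAt_reciprocal hk := (hh.analyticAt_reciprocal (heq.eq_of_nhds ▸ hk)).congr
    (heq.fun_comp _)

theorem HolomorphicAt.comp {h : ℂ → OnePoint ℂ} {g : ℂ → ℂ} {z : ℂ} (hh : HolomorphicAt h (g z))
    (hg : AnalyticAt ℂ g z) : HolomorphicAt (h ∘ g) z where
  continuousAt := hh.continuousAt.comp hg.continuousAt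
  analyticAt_finitePart hk := (hh.analyticAt_finitePart hk).comp hg
  analyticAt_reciprocal hk := (hh.analyticAt_reciprocal hk).comp hg

theorem HolomorphicAt.eventually_ne_infty {h : ℂ → OnePoint ℂ} {z : ℂ} (hh : HolomorphicAt h z)
    (hz : h z ≠ ∞) : ∀ᶠ w in 𝓝 z, h w ≠ ∞ :=
  hh.continuousAt.eventually (isOpen_ne.mem_nhds hz)

/-- Near a point whose value is neither `0` nor `∞`, the coordinate `1 / w` may be used as well. -/
theorem HolomorphicAt.analyticAt_reciprocal_of_ne_zero {h : ℂ → OnePoint ℂ} {z : ℂ}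
    (hh : HolomorphicAt h z) (hz : h z ≠ ((0 : ℂ) : OnePoint ℂ)) :
    AnalyticAt ℂ (reciprocal ∘ h) z := by
  by_cases hi : h z = ∞
  · exact hh.analyticAt_reciprocal hi
  · have h1 := hh.analyticAt_finitePart hi
    have h0 : (finitePart ∘ h) z ≠ 0 := by
      intro h0
      apply hz
      rw [← coe_finitePart hi]
      exact congrArg _ h0
    refine (h1.inv h0).congr ?_
    filter_upwards [hh.eventually_ne_infty hi] with w hw
    simp [reciprocal_of_ne_infty hw]

theorem IsMeromorphic.holomorphicAt {f : ℂ → OnePoint ℂ} (hf : IsMeromorphic f) (z : ℂ) :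
    HolomorphicAt f z := by
  obtain ⟨g, hg, hlim⟩ := hf
  have hev : ∀ᶠ w in 𝓝[≠] z, AnalyticAt ℂ g w := (hg z).eventually_analyticAt
  have hval : ∀ w, AnalyticAt ℂ g w → f w = (g w : OnePoint ℂ) := by
    intro w hw
    have h1 : Tendsto (fun u => (g u : OnePoint ℂ)) (𝓝[≠] w) (𝓝 (g w : OnePoint ℂ)) :=
      ((OnePoint.continuous_coe.tendsto _).comp hw.continuousAt.tendsto).mono_left
        nhdsWithin_le_nhds
    exact tendsto_nhds_unique (hlim w) h1
  have heq : ∀ᶠ w in 𝓝[≠] z, f w = (g w : OnePoint ℂ) := hev.mono hval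
  have hcont : ContinuousAt f z :=
    continuousAt_iff_punctured_nhds.2 ((hlim z).congr' (heq.mono fun w hw => hw.symm))
  have hev2 : ∀ᶠ w in 𝓝[≠] z, ∀ᶠ u in 𝓝 w, f u = (g u : OnePoint ℂ) :=
    hev.mono fun w hw => hw.eventually_analyticAt.mono hval
  refine ⟨hcont, fun hz => ?_, fun hz => ?_⟩
  · refine Complex.analyticAt_of_differentiable_on_punctured_nhds_of_continuousAt ?_
      (ContinuousAt.comp (continuousAt_finitePart hz) hcont)
    filter_upwards [hev, hev2] with w hw hw2
    refine hw.differentiableAt.congr_of_eventuallyEq ?_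
    filter_upwards [hw2] with u hu
    simp [hu]
  · have hcr : ContinuousAt (reciprocal ∘ f) z :=
      ContinuousAt.comp (hz ▸ continuousAt_reciprocal_infty) hcont
    refine Complex.analyticAt_of_differentiable_on_punctured_nhds_of_continuousAt ?_ hcr
    have hne : ∀ᶠ w in 𝓝 z, f w ≠ ((0 : ℂ) : OnePoint ℂ) :=
      hcont.eventually (isOpen_ne.mem_nhds (by rw [hz]; exact OnePoint.infty_ne_coe _))
    filter_upwards [hev, hev2, nhdsWithin_le_nhds hne] with w hw hw2 hne
    have h0 : g w ≠ 0 := by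
      intro h0
      exact hne (by rw [hval w hw, h0])
    refine (hw.differentiableAt.inv h0).congr_of_eventuallyEq ?_
    filter_upwards [hw2] with u hu
    simp [hu]

section Iterates

variable {f : ℂ → OnePoint ℂ}

theorem iter_succ (n : ℕ) (z : ℂ) : iter f (n + 1) z = extend f (iter f n z) :=
  Function.iterate_succ_apply' _ _ _

@[simp] theorem extend_coe (z : ℂ) : extend f (z : OnePoint ℂ) = f z := rfl

@[simp] theorem extend_infty : extend f ∞ = ∞ := rfl

theorem iter_succ_of_eq {n : ℕ} {z w : ℂ} (h : iter f n z = w) : iter f (n + 1) z = f w := by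
  rw [iter_succ, h, extend_coe]

@[simp] theorem iter_one (z : ℂ) : iter f 1 z = f z := rfl

theorem iter_add_of_eq {m : ℕ} {z w : ℂ} (h : iter f m z = w) (n : ℕ) :
    iter f (m + n) z = iter f n w := by
  rw [add_comm, iter, Function.iterate_add_apply]
  exact congrArg _ h

theorem iter_ne_infty_of_le {m n : ℕ} (hmn : m ≤ n) {z : ℂ} (h : iter f n z ≠ ∞) :
    iter f m z ≠ ∞ := by
  induction n, hmn using Nat.le_induction with
  | base => exact h
  | succ k _ ih =>
    refine ih fun hk => h ?_
    rw [iter_succ, hk, extend_infty]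

theorem mem_iterDomain_succ_iff {n : ℕ} {z : ℂ} :
    z ∈ iterDomain f (n + 1) ↔ iter f n z ≠ ∞ :=
  ⟨fun h => h n n.lt_succ_self, fun h _ hj => iter_ne_infty_of_le (Nat.le_of_lt_succ hj) h⟩

theorem mem_iterDomain_of_ne_infty {n : ℕ} {z : ℂ} (h : iter f n z ≠ ∞) : z ∈ iterDomain f n :=
  fun _ hj => iter_ne_infty_of_le hj.le h

theorem mem_iterDomain_of_eq {n : ℕ} {z w : ℂ} (h : iter f n z = w) : z ∈ iterDomain f n :=
  mem_iterDomain_of_ne_infty (h ▸ OnePoint.coe_ne_infty w)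

theorem mem_iterDomain_of_add {m n : ℕ} {z w : ℂ} (h : iter f m z = w)
    (hz : z ∈ iterDomain f (m + n)) : w ∈ iterDomain f n := fun j hj => by
  rw [← iter_add_of_eq h]
  exact hz _ (by omega)

theorem iter_eq_coe {n : ℕ} {z : ℂ} (h : iter f n z ≠ ∞) :
    iter f n z = (finitePart (iter f n z) : ℂ) :=
  (coe_finitePart h).symm

theorem exists_iter_eq_of_forwardInvariant {K : Set ℂ}
    (hK : ∀ z ∈ K, ∃ w ∈ K, f z = (w : OnePoint ℂ)) (n : ℕ) {z : ℂ} (hz : z ∈ K) :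
    ∃ w ∈ K, iter f n z = (w : OnePoint ℂ) := by
  induction n with
  | zero => exact ⟨z, hz, rfl⟩
  | succ n ih =>
    obtain ⟨w, hw, h⟩ := ih
    obtain ⟨v, hv, h'⟩ := hK w hw
    exact ⟨v, hv, by rw [iter_succ_of_eq h, h']⟩

/-- Iterates that agree at some time agree from then on. -/
theorem iter_eq_of_le {m n : ℕ} (hmn : m ≤ n) {x y : ℂ} (h : iter f m x = iter f m y) :
    iter f n x = iter f n y := by
  induction n, hmn using Nat.le_induction with
  | base => exact h
  | succ k _ ih => rw [iter_succ, iter_succ, ih]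

theorem holomorphicAt_iter (hf : ∀ z, HolomorphicAt f z) (n : ℕ) {z : ℂ}
    (hz : z ∈ iterDomain f n) : HolomorphicAt (iter f n) z := by
  induction n with
  | zero =>
    exact ⟨OnePoint.continuous_coe.continuousAt, fun _ => analyticAt_id,
      fun h => absurd h (OnePoint.coe_ne_infty z)⟩
  | succ n ih =>
    have hn : iter f n z ≠ ∞ := mem_iterDomain_succ_iff.1 hz
    have h1 := ih (mem_iterDomain_of_ne_infty hn)
    refine HolomorphicAt.congr (h := f ∘ (finitePart ∘ iter f n))
      ((hf _).comp (h1.analyticAt_finitePart hn)) ?_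
    filter_upwards [h1.eventually_ne_infty hn] with w hw
    exact (iter_succ_of_eq (iter_eq_coe hw)).symm

theorem isOpen_iter_ne_infty (hf : ∀ z, HolomorphicAt f z) (n : ℕ) :
    IsOpen {z | iter f n z ≠ ∞} :=
  isOpen_iff_mem_nhds.2 fun _ hz =>
    (holomorphicAt_iter hf n (mem_iterDomain_of_ne_infty hz)).eventually_ne_infty hz

theorem isOpen_iterDomain (hf : ∀ z, HolomorphicAt f z) (n : ℕ) : IsOpen (iterDomain f n) := by
  rcases n with _ | n
  · convert isOpen_univ
    simp [iterDomain]
  · convert isOpen_iter_ne_infty hf n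
    ext z
    exact mem_iterDomain_succ_iff

theorem isOpen_iterPreimage (hf : ∀ z, HolomorphicAt f z) (n : ℕ) {D : Set (OnePoint ℂ)}
    (hD : IsOpen D) : IsOpen (iterPreimage f n D) :=
  isOpen_iff_mem_nhds.2 fun _ hz => inter_mem ((isOpen_iterDomain hf n).mem_nhds hz.1)
    ((holomorphicAt_iter hf n hz.1).continuousAt (hD.mem_nhds hz.2))

theorem analyticAt_finitePart_iter (hf : ∀ z, HolomorphicAt f z) {n : ℕ} {z : ℂ}
    (hz : iter f n z ≠ ∞) : AnalyticAt ℂ (finitePart ∘ iter f n) z :=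
  (holomorphicAt_iter hf n (mem_iterDomain_of_ne_infty hz)).analyticAt_finitePart hz

theorem iterDeriv_eq (n : ℕ) (z : ℂ) : iterDeriv f n z = deriv (finitePart ∘ iter f n) z := rfl

/-- The chain rule for iterates. -/
theorem iterDeriv_add (hf : ∀ z, HolomorphicAt f z) {m n : ℕ} {z w : ℂ} (h : iter f m z = w)
    (hn : iter f n w ≠ ∞) : iterDeriv f (m + n) z = iterDeriv f n w * iterDeriv f m z := by
  have hm : iter f m z ≠ ∞ := h ▸ OnePoint.coe_ne_infty w
  have h1 := analyticAt_finitePart_iter hf hm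
  have hw : (finitePart ∘ iter f m) z = w := by simp [h]
  have h2 : AnalyticAt ℂ (finitePart ∘ iter f n) ((finitePart ∘ iter f m) z) :=
    hw.symm ▸ analyticAt_finitePart_iter hf hn
  rw [iterDeriv_eq, iterDeriv_eq, iterDeriv_eq, ← hw,
    ← deriv_comp z h2.differentiableAt h1.differentiableAt]
  refine EventuallyEq.deriv_eq ?_
  have hev : ∀ᶠ u in 𝓝 z, iter f m u ≠ ∞ := (isOpen_iter_ne_infty hf m).mem_nhds hm
  filter_upwards [hev] with u hu
  simp only [Function.comp_apply]
  rw [iter_add_of_eq (iter_eq_coe hu)]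

/-- A criterion for conformal pull-backs: an open set that the iterate maps bijectively onto the
plane domain `B` is a component of the preimage of `B`, as the inverse on `B` is continuous. -/
theorem pullsBackConformally_of_bijOn (hf : ∀ z, HolomorphicAt f z) {n : ℕ} {z : ℂ}
    {W B : Set ℂ} (hW : IsOpen W) (hz : z ∈ W) (hB : IsPreconnected B)
    (hbij : BijOn (iter f n) W ((fun w : ℂ => (w : OnePoint ℂ)) '' B)) :
    PullsBackConformally f n z ((fun w : ℂ => (w : OnePoint ℂ)) '' B) := by
  set D : Set (OnePoint ℂ) := (fun w : ℂ => (w : OnePoint ℂ)) '' B with hDdef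
  have hDfin : ∀ w ∈ D, w ≠ ∞ := by
    rintro _ ⟨w, -, rfl⟩
    exact OnePoint.coe_ne_infty w
  have hfin : ∀ x ∈ W, iter f n x ≠ ∞ := fun x hx => hDfin _ (hbij.mapsTo hx)
  have hWP : W ⊆ iterPreimage f n D := fun x hx =>
    ⟨mem_iterDomain_of_ne_infty (hfin x hx), hbij.mapsTo hx⟩
  set G : ℂ → ℂ := finitePart ∘ iter f n with hGdef
  have hGd : DifferentiableOn ℂ G W := fun x hx =>
    (analyticAt_finitePart_iter hf (hfin x hx)).differentiableAt.differentiableWithinAt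
  have hGinj : InjOn G W := by
    intro x hx y hy hxy
    apply hbij.injOn hx hy
    rw [iter_eq_coe (hfin x hx), iter_eq_coe (hfin y hy)]
    exact congrArg _ hxy
  have hGB : G '' W = B := by
    ext b
    constructor
    · rintro ⟨x, hx, rfl⟩
      obtain ⟨b, hb, hbx⟩ := hbij.mapsTo hx
      simp only [hGdef, Function.comp_apply, ← hbx]
      exact hb
    · intro hb
      obtain ⟨x, hx, hxb⟩ := hbij.surjOn (mem_image_of_mem _ hb)
      exact ⟨x, hx, by simp [hGdef, hxb]⟩
  have hinv : LeftInvOn (Function.invFunOn G W) G W := hGinj.leftInvOn_invFunOn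
  set φ := Function.invFunOn G W
  have hφc : ∀ b ∈ B, ContinuousAt φ b := by
    intro b hb
    rw [← hGB] at hb
    obtain ⟨x, hx, rfl⟩ := hb
    exact continuousAt_of_leftInvOn hW hGd hinv hx
  have hWφ : φ '' B = W := by
    rw [← hGB, ← image_comp]
    exact (image_congr fun x hx => hinv hx).trans (image_id _)
  have hWc : IsPreconnected W := by
    rw [← hWφ]
    exact hB.image φ fun b hb => (hφc b hb).continuousWithinAt
  have hsub : connectedComponentIn (iterPreimage f n D) z ⊆ W := by
    refine isPreconnected_connectedComponentIn.subset_of_closure_inter_subset hW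
      ⟨z, mem_connectedComponentIn (hWP hz), hz⟩ ?_
    rintro x ⟨hxcl, hxC⟩
    have hxP := connectedComponentIn_subset _ _ hxC
    obtain ⟨b, hb, hbx⟩ := hxP.2
    have hxfin : iter f n x ≠ ∞ := hDfin _ hxP.2
    have hGx : G x = b := by simp [hGdef, ← hbx]
    have hGc : ContinuousAt G x := (analyticAt_finitePart_iter hf hxfin).continuousAt
    have hlim : Tendsto (φ ∘ G) (𝓝[W] x) (𝓝 (φ (G x))) :=
      (ContinuousAt.comp (hGx.symm ▸ hφc b hb) hGc).tendsto.mono_left nhdsWithin_le_nhds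
    have hlim2 : Tendsto (φ ∘ G) (𝓝[W] x) (𝓝 x) := by
      refine (tendsto_id.mono_left nhdsWithin_le_nhds).congr' ?_
      filter_upwards [self_mem_nhdsWithin] with y hy using (hinv hy).symm
    have := mem_closure_iff_nhdsWithin_neBot.1 hxcl
    rw [← tendsto_nhds_unique hlim hlim2, hGx, ← hWφ]
    exact mem_image_of_mem _ hb
  have heq : connectedComponentIn (iterPreimage f n D) z = W :=
    Subset.antisymm hsub (hWc.subset_connectedComponentIn hz hWP)
  exact ⟨hWP hz, heq.symm ▸ hbij⟩

end Iterates

end MeromorphicDynamics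

namespace MeromorphicDynamics

open Metric

/-! ### The spherical metric -/

theorem exists_chordalDist_lt_imp_sphDist_lt {ε : ℝ} (hε : 0 < ε) :
    ∃ t > 0, ∀ a b, chordalDist a b < t → sphDist a b < ε := by
  have hpi := Real.pi_pos
  refine ⟨Real.sin (min ε (Real.pi / 2)), Real.sin_pos_of_pos_of_lt_pi (by positivity)
    ((min_le_right _ _).trans_lt (by linarith)), fun a b hab => ?_⟩
  refine lt_of_lt_of_le ?_ (min_le_left ε (Real.pi / 2))
  have h0 : 0 < min ε (Real.pi / 2) := by positivity
  exact (Real.arcsin_lt_iff_lt_sin' ⟨by linarith, min_le_right _ _⟩).2 hab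

theorem exists_sphDist_lt_imp_chordalDist_lt {t : ℝ} (ht : 0 < t) :
    ∃ ε > 0, ∀ a b, sphDist a b < ε → chordalDist a b < t := by
  have hpi := Real.pi_pos
  have h0 : 0 < min t (Real.pi / 2) := by positivity
  refine ⟨min t (Real.pi / 2), h0, fun a b hab => ?_⟩
  have h1 := (Real.arcsin_lt_iff_lt_sin' ⟨by linarith, min_le_right _ _⟩).1 hab
  exact h1.trans_le ((Real.sin_le h0.le).trans (min_le_left _ _))

/-- The height of a point of the sphere of diameter one above its south pole `∞`. -/
noncomputable def height (w : OnePoint ℂ) : ℝ := w.elim 0 fun z => 1 / (1 + ‖z‖ ^ 2)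

@[simp] theorem height_coe (z : ℂ) : height z = 1 / (1 + ‖z‖ ^ 2) := rfl

@[simp] theorem height_infty : height ∞ = 0 := rfl

theorem one_div_one_add_sq_le (x : ℝ) : 1 / (1 + x ^ 2) ≤ 1 / Real.sqrt (1 + x ^ 2) := by
  refine one_div_le_one_div_of_le (Real.sqrt_pos.2 (by positivity)) ?_
  rw [Real.sqrt_le_left (by positivity)]
  nlinarith [sq_nonneg x]

theorem abs_height_sub_le (a b : OnePoint ℂ) : |height a - height b| ≤ chordalDist a b := by
  induction a using OnePoint.rec with
  | infty =>
    induction b using OnePoint.rec with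
    | infty => simp [chordalDist]
    | coe w =>
      rw [height_infty, height_coe, zero_sub, abs_neg, abs_of_pos (by positivity)]
      exact one_div_one_add_sq_le _
  | coe z =>
    induction b using OnePoint.rec with
    | infty =>
      rw [height_infty, height_coe, sub_zero, abs_of_pos (by positivity)]
      exact one_div_one_add_sq_le _
    | coe w =>
      change |height z - height w| ≤
        ‖z - w‖ / (Real.sqrt (1 + ‖z‖ ^ 2) * Real.sqrt (1 + ‖w‖ ^ 2))
      rw [height_coe, height_coe]
      set x := ‖z‖
      set y := ‖w‖
      have hx : 0 < 1 + x ^ 2 := by positivity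
      have hy : 0 < 1 + y ^ 2 := by positivity
      set p := Real.sqrt (1 + x ^ 2)
      set q := Real.sqrt (1 + y ^ 2)
      have hp : 0 < p := Real.sqrt_pos.2 hx
      have hq : 0 < q := Real.sqrt_pos.2 hy
      have hp2 : p ^ 2 = 1 + x ^ 2 := Real.sq_sqrt hx.le
      have hq2 : q ^ 2 = 1 + y ^ 2 := Real.sq_sqrt hy.le
      have hx0 : 0 ≤ x := norm_nonneg z
      have hy0 : 0 ≤ y := norm_nonneg w
      have hxy : |y - x| ≤ ‖z - w‖ := by
        rw [norm_sub_rev]; exact abs_norm_sub_norm_le w z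
      have hsum : x + y ≤ p * q := by
        refine abs_le_of_sq_le_sq' ?_ (by positivity) |>.2
        rw [mul_pow, hp2, hq2]
        nlinarith [sq_nonneg (x * y - 1)]
      rw [← hp2, ← hq2]
      have heq : 1 / p ^ 2 - 1 / q ^ 2 = (y - x) * (x + y) / (p * q * (p * q)) := by
        field_simp
        rw [hp2, hq2]; ring
      rw [heq, abs_div, abs_mul, abs_of_nonneg (by positivity : 0 ≤ x + y),
        abs_of_pos (by positivity : 0 < p * q * (p * q)), div_le_div_iff₀ (by positivity)
        (by positivity)]
      calc |y - x| * (x + y) * (p * q) ≤ ‖z - w‖ * (p * q) * (p * q) := by gcongr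
        _ = _ := by ring

/-- Small spherical disks about points of a bounded set are convex plane domains. -/
theorem exists_sphDisk_eq_image (M : ℝ) {δ : ℝ} (hδ : 0 < δ) : ∃ δ' > 0, ∀ w : ℂ, ‖w‖ ≤ M →
    ∃ B : Set ℂ, IsOpen B ∧ Convex ℝ B ∧ w ∈ B ∧ B ⊆ ball w δ ∧
      sphDisk w δ' = (fun z : ℂ => (z : OnePoint ℂ)) '' B := by
  set m := max M 0 with hm
  have hm0 : 0 ≤ m := le_max_right _ _
  set s := min (1 / 2) (δ / 2) / (1 + m) ^ 2 with hs
  have hs0 : 0 < s := by positivity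
  have hs1 : s * (1 + m) ^ 2 = min (1 / 2) (δ / 2) := by rw [hs]; field_simp
  have hsa : s * (1 + m) ^ 2 ≤ 1 / 2 := hs1 ▸ min_le_left _ _
  have hsb : s * (1 + m) ^ 2 ≤ δ / 2 := hs1 ▸ min_le_right _ _
  have hsc : s * (1 + m) ≤ 1 / 2 := by nlinarith [mul_nonneg hs0.le hm0]
  have hsd : s ≤ 1 / 2 := by nlinarith [mul_nonneg hs0.le hm0]
  have harc : 0 < Real.arcsin s := Real.arcsin_pos.2 hs0
  refine ⟨Real.arcsin s, harc, fun w hw => ?_⟩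
  have hw' : ‖w‖ ≤ m := hw.trans (le_max_left _ _)
  have hpi := Real.pi_pos
  have hiff : ∀ a, a ∈ sphDisk (w : OnePoint ℂ) (Real.arcsin s) ↔ chordalDist a w < s := by
    intro a
    change Real.arcsin _ < _ ↔ _
    rw [Real.arcsin_lt_iff_lt_sin' ⟨by linarith, Real.arcsin_le_pi_div_two s⟩,
      Real.sin_arcsin (by linarith) (by linarith)]
  have hsq : ∀ z : ℂ, 0 < Real.sqrt (1 + ‖z‖ ^ 2) := fun z => Real.sqrt_pos.2 (by positivity)
  have hsqle : ∀ z : ℂ, Real.sqrt (1 + ‖z‖ ^ 2) ≤ 1 + ‖z‖ := fun z => by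
    rw [Real.sqrt_le_left (by positivity)]
    nlinarith [norm_nonneg z]
  set k := s ^ 2 * (1 + ‖w‖ ^ 2) with hk
  have hk1 : k < 1 := by
    have : s ^ 2 * (1 + ‖w‖ ^ 2) ≤ (s * (1 + m)) ^ 2 := by
      rw [mul_pow]
      gcongr
      nlinarith [norm_nonneg w]
    nlinarith [mul_nonneg hs0.le (by positivity : 0 ≤ 1 + m)]
  have hmem : ∀ z : ℂ, chordalDist z w < s ↔ ‖z - w‖ ^ 2 - k * (1 + ‖z‖ ^ 2) < 0 := by
    intro z
    change ‖z - w‖ / (Real.sqrt (1 + ‖z‖ ^ 2) * Real.sqrt (1 + ‖w‖ ^ 2)) < s ↔ _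
    rw [div_lt_iff₀ (mul_pos (hsq z) (hsq w)), sub_neg,
      ← pow_lt_pow_iff_left₀ (norm_nonneg _) (by positivity) two_ne_zero, mul_pow, mul_pow,
      Real.sq_sqrt (by positivity), Real.sq_sqrt (by positivity), hk]
    ring_nf
  refine ⟨{z : ℂ | ‖z - w‖ ^ 2 - k * (1 + ‖z‖ ^ 2) < 0}, ?_, ?_, ?_, ?_, ?_⟩
  · exact isOpen_lt (by fun_prop) continuous_const
  · intro x hx y hy a b ha hb hab
    simp only [mem_ofPred_eq] at *
    have hid : ‖a • x + b • y - w‖ ^ 2 - k * (1 + ‖a • x + b • y‖ ^ 2) =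
        a * (‖x - w‖ ^ 2 - k * (1 + ‖x‖ ^ 2)) + b * (‖y - w‖ ^ 2 - k * (1 + ‖y‖ ^ 2)) -
          a * b * ((1 - k) * ‖x - y‖ ^ 2) := by
      obtain rfl : b = 1 - a := by linarith
      simp only [Complex.sq_norm, Complex.normSq_apply, Complex.add_re, Complex.sub_re,
        Complex.add_im, Complex.sub_im, Complex.real_smul, Complex.mul_re, Complex.mul_im,
        Complex.ofReal_re, Complex.ofReal_im]
      ring
    rw [hid]
    have h3 : 0 ≤ a * b * ((1 - k) * ‖x - y‖ ^ 2) := by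
      have : 0 ≤ 1 - k := by linarith
      positivity
    rcases eq_or_lt_of_le ha with rfl | ha'
    · obtain rfl : b = 1 := by linarith
      linarith
    · have h4 := mul_neg_of_pos_of_neg ha' hx
      have h5 := mul_nonpos_of_nonneg_of_nonpos hb hy.le
      linarith
  · simp only [mem_ofPred_eq, sub_self, norm_zero]
    have : 0 < k * (1 + ‖w‖ ^ 2) := by positivity
    linarith
  · intro z hz
    have h1 := (hmem z).2 hz
    change ‖z - w‖ / (Real.sqrt (1 + ‖z‖ ^ 2) * Real.sqrt (1 + ‖w‖ ^ 2)) < s at h1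
    rw [div_lt_iff₀ (mul_pos (hsq z) (hsq w))] at h1
    rw [mem_ball, dist_eq_norm]
    have h2 : ‖z‖ ≤ m + ‖z - w‖ := by
      have := norm_sub_norm_le z w
      linarith
    have h3 : ‖z - w‖ < s * ((1 + (m + ‖z - w‖)) * (1 + m)) := by
      refine h1.trans_le ?_
      gcongr
      · exact (hsqle z).trans (by linarith)
      · exact (hsqle w).trans (by linarith)
    have h4 : s * ((1 + (m + ‖z - w‖)) * (1 + m)) =
        s * (1 + m) ^ 2 + s * (1 + m) * ‖z - w‖ := by ring
    have h5 : s * (1 + m) * ‖z - w‖ ≤ 1 / 2 * ‖z - w‖ := by gcongr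
    linarith
  · ext a
    rw [hiff]
    induction a using OnePoint.rec with
    | infty =>
      change 1 / Real.sqrt (1 + ‖w‖ ^ 2) < s ↔ _
      simp only [mem_image, OnePoint.coe_ne_infty, and_false, exists_false, iff_false, not_lt]
      rw [le_div_iff₀ (hsq w)]
      calc s * Real.sqrt (1 + ‖w‖ ^ 2) ≤ s * (1 + m) := by
            gcongr
            exact (hsqle w).trans (by linarith)
        _ ≤ 1 := by linarith
    | coe z => rw [hmem]; simp

/-! ### Hyperbolic sets and the two radial Julia sets -/

variable {f : ℂ → OnePoint ℂ}

theorem radialJuliaSet_subset_sphRadialJuliaSet (hf : ∀ z, HolomorphicAt f z) :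
    radialJuliaSet f ⊆ sphRadialJuliaSet f := by
  rintro z ⟨hzJ, δ, hδ, n, w, hn, hunb, hw, ⟨M, hM⟩, hpull⟩
  obtain ⟨δ', hδ', hdisk⟩ := exists_sphDisk_eq_image M hδ
  refine ⟨hzJ, δ', hδ', n, hn, hunb, fun j => ?_⟩
  obtain ⟨B, hBo, hBc, hwB, hBsub, hB⟩ := hdisk (w j) (hM ⟨j, rfl⟩)
  obtain ⟨hzP, hbij⟩ := hpull j
  rw [(hw j).2, hB]
  set U := connectedComponentIn (iterPreimage f (n j) (euclDisk (w j) δ)) z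
  have hUo : IsOpen U := (isOpen_iterPreimage hf _
    (OnePoint.isOpenEmbedding_coe.isOpenMap _ isOpen_ball)).connectedComponentIn
  have hBo' := OnePoint.isOpenEmbedding_coe.isOpenMap _ hBo
  refine pullsBackConformally_of_bijOn hf (W := U ∩ iterPreimage f (n j)
    ((fun w : ℂ => (w : OnePoint ℂ)) '' B)) (hUo.inter (isOpen_iterPreimage hf _ hBo'))
    ⟨mem_connectedComponentIn hzP, (hw j).1, ?_⟩ hBc.isPreconnected ⟨fun x hx => hx.2.2,
    hbij.injOn.mono inter_subset_left, ?_⟩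
  · rw [(hw j).2]; exact mem_image_of_mem _ hwB
  · intro b hb
    obtain ⟨x, hx, hxb⟩ := hbij.surjOn (image_mono hBsub hb)
    exact ⟨x, ⟨hx, (connectedComponentIn_subset _ _ hx).1, hxb.symm ▸ hb⟩, hxb⟩

theorem IsHyperbolicSet.exists_iter_eq {K : Set ℂ} (hK : IsHyperbolicSet f K) (n : ℕ) {z : ℂ}
    (hz : z ∈ K) : ∃ w ∈ K, iter f n z = (w : OnePoint ℂ) :=
  exists_iter_eq_of_forwardInvariant hK.forwardInvariant n hz

/-- At a point of a hyperbolic set the derivatives of the iterates are unbounded, whereas the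
iterates stay bounded there; by Cauchy's estimate they cannot form a normal family. -/
theorem IsHyperbolicSet.subset_juliaSet (hf : ∀ z, HolomorphicAt f z) {K : Set ℂ}
    (hK : IsHyperbolicSet f K) : K ⊆ juliaSet f := by
  rintro z hz ⟨U, hUo, hzU, hdom, hnormal⟩
  obtain ⟨M, hM⟩ := hK.isCompact.isBounded.exists_norm_le
  obtain ⟨φ, hφ, g, hg⟩ := hnormal (fun i => i + 1) (fun i => Nat.le_add_left 1 i)
  have hM0 : 0 ≤ M := (norm_nonneg z).trans (hM z hz)
  set η := 1 / (1 + M ^ 2) with hη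
  have hη0 : 0 < η := by positivity
  obtain ⟨R, hR, hRU⟩ := Metric.isOpen_iff.1 hUo z hzU
  obtain ⟨ε, hε, hεt⟩ := exists_sphDist_lt_imp_chordalDist_lt (t := η / 8) (by positivity)
  have hev := hg (closedBall z (R / 2)) ((closedBall_subset_ball (by linarith)).trans hRU)
    (isCompact_closedBall _ _) ε hε
  obtain ⟨i₀, hi₀⟩ := eventually_atTop.1 hev
  have hh : ∀ i ≥ i₀, ∀ x ∈ closedBall z (R / 2),
      |height (iter f (φ i + 1) x) - height (iter f (φ i₀ + 1) x)| ≤ η / 4 := by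
    intro i hi x hx
    have h1 := (abs_height_sub_le _ _).trans (hεt _ _ (hi₀ i hi x hx)).le
    have h2 := (abs_height_sub_le _ _).trans (hεt _ _ (hi₀ i₀ le_rfl x hx)).le
    rw [abs_le] at *
    constructor <;> linarith [h1.1, h1.2, h2.1, h2.2]
  have hheight : ∀ n, η ≤ height (iter f n z) := by
    intro n
    obtain ⟨w, hw, h⟩ := hK.exists_iter_eq n hz
    rw [h, height_coe, hη]
    have := hM w hw
    gcongr
  have hfin : ∀ n x, x ∈ U → iter f n x ≠ ∞ := fun n x hx =>
    mem_iterDomain_succ_iff.1 (hdom (n + 1) (Nat.le_add_left 1 n) hx)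
  have hcont : ContinuousAt (fun x => height (iter f (φ i₀ + 1) x)) z := by
    have h1 := (analyticAt_finitePart_iter hf (hfin (φ i₀ + 1) z hzU)).continuousAt
    have h2 : ContinuousAt (fun x => 1 / (1 + ‖(finitePart ∘ iter f (φ i₀ + 1)) x‖ ^ 2)) z :=
      continuousAt_const.div (continuousAt_const.add (h1.norm.pow 2)) (by positivity)
    refine h2.congr ?_
    filter_upwards [hUo.mem_nhds hzU] with x hx
    rw [iter_eq_coe (hfin (φ i₀ + 1) x hx), height_coe]
    rfl
  have hev2 : ∀ᶠ x in 𝓝 z, η / 2 < height (iter f (φ i₀ + 1) x) :=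
    hcont.eventually (lt_mem_nhds (lt_of_lt_of_le (by linarith) (hheight _)))
  obtain ⟨r, hr, hrb⟩ := Metric.eventually_nhds_iff_ball.1 hev2
  set ρ := min (r / 2) (R / 2) with hρ
  have hρ0 : 0 < ρ := by positivity
  have hρr : closedBall z ρ ⊆ ball z r :=
    closedBall_subset_ball ((min_le_left _ _).trans_lt (by linarith))
  have hρR : closedBall z ρ ⊆ closedBall z (R / 2) := closedBall_subset_closedBall (min_le_right _ _)
  have hρU : closedBall z ρ ⊆ U :=
    hρR.trans ((closedBall_subset_ball (by linarith)).trans hRU)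
  have hbound : ∀ i ≥ i₀, ∀ x ∈ closedBall z ρ,
      ‖(finitePart ∘ iter f (φ i + 1)) x‖ ≤ 4 / η := by
    intro i hi x hx
    have h1 := (abs_le.1 (hh i hi x (hρR hx))).1
    have h2 := hrb x (hρr hx)
    have h3 : η / 4 < height (iter f (φ i + 1) x) := by linarith
    rw [iter_eq_coe (hfin (φ i + 1) x (hρU hx)), height_coe, lt_div_iff₀ (by positivity)] at h3
    simp only [Function.comp_apply]
    rw [le_div_iff₀ hη0]
    have hη1 : η ≤ 1 := by
      rw [hη, div_le_one (by positivity)]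
      nlinarith
    nlinarith [sq_nonneg (‖finitePart (iter f (φ i + 1) x)‖ - 1)]
  have hderiv : ∀ i ≥ i₀, ‖iterDeriv f (φ i + 1) z‖ ≤ 4 / η / ρ := by
    intro i hi
    rw [iterDeriv_eq]
    refine Complex.norm_deriv_le_of_forall_mem_sphere_norm_le hρ0 ?_
      (fun x hx => hbound i hi x (sphere_subset_closedBall hx))
    refine DifferentiableOn.diffContOnCl fun x hx => ?_
    rw [closure_ball _ hρ0.ne'] at hx
    exact (analyticAt_finitePart_iter hf
      (hfin (φ i + 1) x (hρU hx))).differentiableAt.differentiableWithinAt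
  obtain ⟨c, hc, γ, hγ, hexp⟩ := hK.expanding
  obtain ⟨N, hN⟩ := pow_unbounded_of_one_lt (4 / η / ρ / c) hγ
  have hNi : N ≤ φ (max N i₀) + 1 := ((le_max_left _ _).trans (hφ.id_le _)).trans (Nat.le_succ _)
  have h1 := hexp (φ (max N i₀) + 1) (Nat.le_add_left 1 _) z hz
  have h2 := hderiv (max N i₀) (le_max_right _ _)
  have h3 : γ ^ N ≤ γ ^ (φ (max N i₀) + 1) := pow_le_pow_right₀ hγ.le hNi
  rw [div_lt_iff₀ hc] at hN
  nlinarith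

/-- A suitable iterate of `f` is, near each point of a hyperbolic set, injective and expanding on
a disk of a fixed radius. -/
theorem IsHyperbolicSet.exists_uniform_radius (hf : ∀ z, HolomorphicAt f z) {K : Set ℂ}
    (hK : IsHyperbolicSet f K) : ∃ N ≥ 1, ∃ r > 0, ∀ z ∈ K,
      (∀ x ∈ ball z r, iter f N x ≠ ∞) ∧ InjOn (finitePart ∘ iter f N) (ball z r) ∧
      ball (finitePart (iter f N z)) r ⊆ (finitePart ∘ iter f N) '' ball z r := by
  obtain ⟨c, hc, γ, hγ, hexp⟩ := hK.expanding
  obtain ⟨N₀, hN₀⟩ := pow_unbounded_of_one_lt (4 / c) hγ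
  set N := N₀ + 1
  have hN : 4 ≤ c * γ ^ N := by
    have : γ ^ N₀ ≤ γ ^ N := pow_le_pow_right₀ hγ.le (Nat.le_succ _)
    rw [div_lt_iff₀ hc] at hN₀
    nlinarith
  set G := finitePart ∘ iter f N with hG
  have hKfin : ∀ z ∈ K, iter f N z ≠ ∞ := fun z hz => by
    obtain ⟨w, -, h⟩ := hK.exists_iter_eq N hz
    rw [h]; exact OnePoint.coe_ne_infty w
  have hloc : ∀ z ∈ K, ∃ r > 0, ∀ x ∈ ball z r, iter f N x ≠ ∞ ∧ ‖deriv G x - deriv G z‖ < 1 / 2 := by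
    intro z hz
    refine Metric.eventually_nhds_iff_ball.1 ?_
    refine Filter.Eventually.and ((isOpen_iter_ne_infty hf N).mem_nhds (hKfin z hz)) ?_
    have := (analyticAt_finitePart_iter hf (hKfin z hz)).deriv.continuousAt.eventually
      (ball_mem_nhds _ (by norm_num : (0 : ℝ) < 1 / 2))
    filter_upwards [this] with x hx
    rwa [dist_eq_norm] at hx
  choose! ρ hρ hρb using hloc
  obtain ⟨r, hr, hleb⟩ := lebesgue_number_lemma_of_metric (c := fun z : K => ball (z : ℂ) (ρ z))
    hK.isCompact (fun _ => isOpen_ball)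
    (fun z hz => mem_iUnion.2 ⟨⟨z, hz⟩, mem_ball_self (hρ z hz)⟩)
  refine ⟨N, Nat.le_add_left 1 _, r, hr, fun z hz => ?_⟩
  obtain ⟨⟨z₀, hz₀⟩, hsub⟩ := hleb z hz
  have hfin : ∀ x ∈ ball z r, iter f N x ≠ ∞ := fun x hx => (hρb z₀ hz₀ x (hsub hx)).1
  have hder : ∀ x ∈ ball z r, ‖deriv G x - deriv G z‖ ≤ 1 := fun x hx => by
    have h1 := (hρb z₀ hz₀ x (hsub hx)).2
    have h2 := (hρb z₀ hz₀ z (hsub (mem_ball_self hr))).2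
    have h3 := norm_sub_le (deriv G x - deriv G z₀) (deriv G z - deriv G z₀)
    rw [sub_sub_sub_cancel_right] at h3
    linarith
  have hd : DifferentiableOn ℂ G (ball z r) := fun x hx =>
    (analyticAt_finitePart_iter hf (hfin x hx)).differentiableAt.differentiableWithinAt
  have h4 : 4 ≤ ‖deriv G z‖ := hN.trans (hexp N (Nat.le_add_left 1 _) z hz)
  have hlow : ∀ x ∈ ball z r, ∀ y ∈ ball z r, 3 * ‖x - y‖ ≤ ‖G x - G y‖ := by
    intro x hx y hy
    refine le_trans ?_ (mul_norm_sub_le_norm_image_sub (convex_ball z r) (fun t ht =>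
      hd.differentiableAt (isOpen_ball.mem_nhds ht)) hder hx hy)
    gcongr
    linarith
  refine ⟨hfin, fun x hx y hy hxy => ?_, ?_⟩
  · have := hlow x hx y hy
    rw [show G x = G y from hxy, sub_self, norm_zero] at this
    exact sub_eq_zero.1 (norm_eq_zero.1 (le_antisymm (by linarith) (norm_nonneg _)))
  · have hsub2 : closedBall z (2 / 3 * r) ⊆ ball z r := closedBall_subset_ball (by linarith)
    have hopen := ball_subset_image_closedBall_of_le (t := 2 / 3 * r) (by positivity) three_pos
      (hd.mono hsub2) fun x hx => hlow x (hsub2 hx) z (mem_ball_self hr)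
    rw [show 3 * (2 / 3 * r) / 2 = r by ring] at hopen
    exact hopen.trans (image_mono hsub2)

theorem IsHyperbolicSet.subset_radialJuliaSet (hf : ∀ z, HolomorphicAt f z) {K : Set ℂ}
    (hK : IsHyperbolicSet f K) : K ⊆ radialJuliaSet f := by
  intro z hz
  obtain ⟨N, hN, r, hr, hloc⟩ := hK.exists_uniform_radius hf
  have hpull : ∀ j : ℕ, ∀ z ∈ K, ∃ W : Set ℂ, IsOpen W ∧ z ∈ W ∧ W ⊆ ball z r ∧
      BijOn (iter f (N * j)) W (euclDisk (finitePart (iter f (N * j) z)) r) := by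
    intro j
    induction j with
    | zero =>
      intro z _
      exact ⟨ball z r, isOpen_ball, mem_ball_self hr, Subset.rfl,
        (OnePoint.coe_injective.injOn).bijOn_image⟩
    | succ j ih =>
      intro z hz
      obtain ⟨hfin, hinj, hsurj⟩ := hloc z hz
      obtain ⟨w, hw, hzw⟩ := hK.exists_iter_eq N hz
      obtain ⟨W, hWo, hwW, hWb, hbij⟩ := ih w hw
      rw [hzw, finitePart_coe] at hsurj
      have hval : ∀ x ∈ ball z r, iter f (N * (j + 1)) x =
          iter f (N * j) (finitePart (iter f N x)) := fun x hx => by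
        rw [mul_add, mul_one, add_comm, iter_add_of_eq (iter_eq_coe (hfin x hx))]
      have hd : ContinuousOn (finitePart ∘ iter f N) (ball z r) := fun x hx =>
        (analyticAt_finitePart_iter hf (hfin x hx)).continuousAt.continuousWithinAt
      refine ⟨ball z r ∩ (finitePart ∘ iter f N) ⁻¹' W, hd.isOpen_inter_preimage isOpen_ball hWo,
        ⟨mem_ball_self hr, by simpa [hzw] using hwW⟩, inter_subset_left, ?_⟩
      have hz' : iter f (N * (j + 1)) z = iter f (N * j) w := by
        rw [hval z (mem_ball_self hr), hzw, finitePart_coe]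
      rw [hz']
      refine ⟨fun x hx => ?_, fun x hx y hy hxy => ?_, fun b hb => ?_⟩
      · rw [hval x hx.1]
        exact hbij.mapsTo hx.2
      · rw [hval x hx.1, hval y hy.1] at hxy
        exact hinj hx.1 hy.1 (hbij.injOn hx.2 hy.2 hxy)
      · obtain ⟨v, hv, hvb⟩ := hbij.surjOn hb
        obtain ⟨x, hx, rfl⟩ := hsurj (hWb hv)
        exact ⟨x, ⟨hx, hv⟩, by rw [hval x hx]; exact hvb⟩
  choose w hwK hw using fun n => hK.exists_iter_eq n hz
  obtain ⟨M, hM⟩ := hK.isCompact.isBounded.exists_norm_le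
  refine ⟨hK.subset_juliaSet hf hz, r, hr, fun j => N * (j + 1), fun j => w (N * (j + 1)),
    fun j => by positivity, ?_, fun j => ⟨mem_iterDomain_of_eq (hw _), hw _⟩, ?_, fun j => ?_⟩
  · rintro ⟨b, hb⟩
    have := hb ⟨b, rfl⟩
    have h2 : b + 1 ≤ N * (b + 1) := Nat.le_mul_of_pos_left _ hN
    simp only at this
    omega
  · refine ⟨M, ?_⟩
    rintro _ ⟨j, rfl⟩
    exact hM _ (hwK _)
  · obtain ⟨W, hWo, hzW, -, hbij⟩ := hpull (j + 1) z hz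
    rw [hw, finitePart_coe] at hbij
    exact pullsBackConformally_of_bijOn hf hWo hzW (convex_ball _ _).isPreconnected hbij

end MeromorphicDynamics

namespace MeromorphicDynamics

open Metric

/-! ### Domains on which all iterates are univalent -/

theorem chordalDist_coe_le (z w : ℂ) : chordalDist z w ≤ ‖z - w‖ := by
  change ‖z - w‖ / (Real.sqrt (1 + ‖z‖ ^ 2) * Real.sqrt (1 + ‖w‖ ^ 2)) ≤ ‖z - w‖
  have h : ∀ z : ℂ, 1 ≤ Real.sqrt (1 + ‖z‖ ^ 2) := fun z =>
    Real.one_le_sqrt.2 (by nlinarith [sq_nonneg ‖z‖])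
  exact div_le_self (norm_nonneg _) (one_le_mul_of_one_le_of_one_le (h z) (h w))

theorem norm_mul_chordalDist_infty_le (z : ℂ) : ‖z‖ * chordalDist z ∞ ≤ 1 := by
  change ‖z‖ * (1 / Real.sqrt (1 + ‖z‖ ^ 2)) ≤ 1
  rw [mul_one_div, div_le_one (Real.sqrt_pos.2 (by positivity))]
  exact Real.le_sqrt_of_sq_le (by linarith)

variable {f : ℂ → OnePoint ℂ}

/-- A transcendental function is not injective on the plane: an injective entire function has
bounded derivative by the distortion theorem, so that it is affine by Liouville's theorem. -/
theorem IsTranscendentalMeromorphic.exists_not_injOn (hf : IsTranscendentalMeromorphic f) :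
    ∃ R > 0, ¬ ((∀ x ∈ ball (0 : ℂ) R, f x ≠ ∞) ∧ InjOn f (ball 0 R)) := by
  have hhol := hf.1.holomorphicAt
  by_contra! hcon
  apply hf.2
  have hfin : ∀ x, f x ≠ ∞ := fun x =>
    (hcon (‖x‖ + 1) (by positivity)).1 x (by simp)
  set F := finitePart ∘ f with hF
  have hd : Differentiable ℂ F := fun x => ((hhol x).analyticAt_finitePart (hfin x)).differentiableAt
  have hinj : ∀ R > 0, InjOn F (ball 0 R) := fun R hR x hx y hy hxy => by
    apply (hcon R hR).2 hx hy
    rw [← coe_finitePart (hfin x), ← coe_finitePart (hfin y)]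
    exact congrArg _ hxy
  have hbdd : ∀ x, ‖deriv F x‖ ≤ distortionConst * ‖deriv F 0‖ := fun x =>
    norm_deriv_le_of_injOn (r := 2 * (‖x‖ + 1)) hd.differentiableOn
      (hinj _ (by positivity)) (by simp)
  have hd' : Differentiable ℂ (deriv F) := fun x =>
    (hd.differentiableOn.deriv isOpen_univ).differentiableAt univ_mem
  have hconst : ∀ x, deriv F x = deriv F 0 := fun x =>
    hd'.apply_eq_apply_of_bounded
      (isBounded_iff_forall_norm_le.2 ⟨_, by rintro _ ⟨y, rfl⟩; exact hbdd y⟩) x 0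
  have haff : ∀ x, F x - deriv F 0 * x = F 0 := fun x => by
    have hg : ∀ y, HasDerivAt (fun y => F y - deriv F 0 * y) (deriv F y - deriv F 0 * 1) y :=
      fun y => (hd y).hasDerivAt.sub ((hasDerivAt_id y).const_mul _)
    have := is_const_of_deriv_eq_zero (fun y => (hg y).differentiableAt)
      (fun y => by rw [(hg y).deriv, hconst y, mul_one, sub_self]) x 0
    simpa using this
  refine ⟨Polynomial.C (deriv F 0) * Polynomial.X + Polynomial.C (F 0), 1, one_ne_zero,
    fun z _ => ?_⟩
  rw [← coe_finitePart (hfin z)]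
  congr 1
  have := haff z
  simp only [Polynomial.eval_add, Polynomial.eval_mul, Polynomial.eval_C, Polynomial.eval_X,
    Polynomial.eval_one, div_one]
  rw [← this]
  simp [hF]

/-- The Arzelà–Ascoli theorem for uniformly bounded and uniformly Lipschitz sequences. -/
theorem exists_subseq_uniform_limit {z : ℂ} {ρ M L : ℝ} (h : ℕ → ℂ → ℂ)
    (hb : ∀ i, ∀ x ∈ closedBall z ρ, ‖h i x‖ ≤ M)
    (hL : ∀ i, ∀ x ∈ closedBall z ρ, ∀ y ∈ closedBall z ρ, dist (h i x) (h i y) ≤ L * dist x y) :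
    ∃ φ : ℕ → ℕ, StrictMono φ ∧ ∃ g : ℂ → ℂ, ∀ ε > 0, ∀ᶠ i in atTop,
      ∀ x ∈ closedBall z ρ, dist (h (φ i) x) (g x) < ε := by
  classical
  have : CompactSpace (closedBall z ρ) := isCompact_iff_compactSpace.1 (isCompact_closedBall z ρ)
  have hlip : ∀ i, LipschitzWith L.toNNReal fun x : closedBall z ρ => h i x := fun i =>
    LipschitzWith.of_dist_le_mul fun x y => (hL i x x.2 y y.2).trans (by
      rw [Subtype.dist_eq]
      gcongr
      exact Real.le_coe_toNNReal L)
  let H : ℕ → BoundedContinuousFunction (closedBall z ρ) ℂ := fun i =>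
    BoundedContinuousFunction.mkOfCompact ⟨fun x => h i x, (hlip i).continuous⟩
  have hcomp : IsCompact (closure (range H)) := by
    refine BoundedContinuousFunction.arzela_ascoli (closedBall 0 M) (isCompact_closedBall _ _) _
      ?_ ?_
    · rintro _ x ⟨i, rfl⟩
      exact mem_closedBall_zero_iff.2 (hb i x x.2)
    · refine (LipschitzWith.uniformEquicontinuous _ L.toNNReal ?_).equicontinuous
      rintro ⟨_, i, rfl⟩
      exact hlip i
  obtain ⟨G, -, φ, hφ, hlim⟩ := hcomp.tendsto_subseq
    (fun i => subset_closure (mem_range_self (f := H) i))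
  refine ⟨φ, hφ, fun x => if hx : x ∈ closedBall z ρ then G ⟨x, hx⟩ else 0, fun ε hε => ?_⟩
  filter_upwards [(Metric.tendsto_nhds.1 hlim) ε hε] with i hi x hx
  rw [dif_pos hx]
  exact (BoundedContinuousFunction.dist_coe_le_dist (⟨x, hx⟩ : closedBall z ρ)).trans_lt hi

/-- If all iterates are finite and univalent on a disk, its centre lies in the Fatou set. As `f` is
not injective on some disk `D(0, R)`, no iterate covers that disk, and univalent functions that omit
bounded values form a normal family. -/
theorem IsTranscendentalMeromorphic.mem_fatouSet_of_injOn (hf : IsTranscendentalMeromorphic f)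
    {z : ℂ} {r : ℝ} (hr : 0 < r) (hfin : ∀ k, ∀ x ∈ ball z r, iter f k x ≠ ∞)
    (hinj : ∀ k, InjOn (iter f k) (ball z r)) : z ∈ fatouSet f := by
  have hhol := hf.1.holomorphicAt
  obtain ⟨R, hR, hnot⟩ := hf.exists_not_injOn
  set G : ℕ → ℂ → ℂ := fun k => finitePart ∘ iter f k with hG
  have hGc : ∀ k, ∀ x ∈ ball z r, iter f k x = (G k x : OnePoint ℂ) := fun k x hx =>
    iter_eq_coe (hfin k x hx)
  have hGd : ∀ k, DifferentiableOn ℂ (G k) (ball z r) := fun k x hx =>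
    (analyticAt_finitePart_iter hhol (hfin k x hx)).differentiableAt.differentiableWithinAt
  have hGi : ∀ k, InjOn (G k) (ball z r) := fun k x hx y hy hxy => by
    apply hinj k hx hy
    rw [hGc k x hx, hGc k y hy, hxy]
  have homit : ∀ k, ∃ p, ‖p‖ < R ∧ p ∉ G k '' ball z r := by
    intro k
    by_contra! hcon
    refine hnot ⟨fun y hy => ?_, fun y hy y' hy' hyy => ?_⟩
    · obtain ⟨x, hx, hxy⟩ := hcon y (by simpa using hy)
      rw [← hxy, ← iter_succ_of_eq (hGc k x hx)]
      exact hfin _ x hx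
    · obtain ⟨x, hx, hxy⟩ := hcon y (by simpa using hy)
      obtain ⟨x', hx', hxy'⟩ := hcon y' (by simpa using hy')
      rw [← hxy, ← hxy', ← iter_succ_of_eq (hGc k x hx), ← iter_succ_of_eq (hGc k x' hx')] at hyy
      rw [← hxy, ← hxy', hinj _ hx hx' hyy]
  choose p hpR hp using homit
  set A : ℕ → ℝ := fun k => ‖G k z - p k‖ with hA
  have hD := one_le_distortionConst
  have hK := koebeConst_pos
  set L := distortionConst * koebeConst / r with hL
  have hL0 : 0 < L := by positivity
  have hder : ∀ k, ‖deriv (G k) z‖ ≤ koebeConst / r * A k := fun k => by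
    have := mul_norm_deriv_le_of_notMem_image hr (hGd k) (hGi k) (hp k)
    calc ‖deriv (G k) z‖ = r * ‖deriv (G k) z‖ / r := by field_simp
      _ ≤ koebeConst * A k / r := by gcongr
      _ = _ := by ring
  have hlip : ∀ k, ∀ x ∈ ball z (r / 2), ∀ y ∈ ball z (r / 2),
      dist (G k x) (G k y) ≤ L * A k * dist x y := fun k x hx y hy => by
    refine (dist_le_of_injOn (hGd k) (hGi k) hx hy).trans ?_
    calc distortionConst * ‖deriv (G k) z‖ * dist x y
        ≤ distortionConst * (koebeConst / r * A k) * dist x y := by gcongr; exact hder k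
      _ = _ := by rw [hL]; ring
  set ρ := min (r / 4) (1 / (2 * L)) with hρ
  have hρ0 : 0 < ρ := by positivity
  have hρr : closedBall z ρ ⊆ ball z (r / 2) :=
    closedBall_subset_ball ((min_le_left _ _).trans_lt (by linarith))
  have hρr' : closedBall z ρ ⊆ ball z r := hρr.trans (ball_subset_ball (by linarith))
  have hdev : ∀ k, ∀ x ∈ closedBall z ρ, dist (G k x) (G k z) ≤ A k / 2 := fun k x hx => by
    refine (hlip k x (hρr hx) z (mem_ball_self (half_pos hr))).trans ?_
    calc L * A k * dist x z ≤ L * A k * (1 / (2 * L)) := by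
          gcongr
          exact (mem_closedBall.1 hx).trans (min_le_right _ _)
      _ = A k / 2 := by field_simp
  refine ⟨ball z ρ, isOpen_ball, mem_ball_self hρ0, fun k _ x hx =>
    mem_iterDomain_of_ne_infty (hfin k x (hρr' (ball_subset_closedBall hx))), fun k _ => ?_⟩
  by_cases hcase : ∀ n : ℕ, ∃ᶠ i in atTop, (n : ℝ) ≤ A (k i)
  · obtain ⟨φ, hφ, hφA⟩ := extraction_forall_of_frequently hcase
    refine ⟨φ, hφ, fun _ => ∞, fun C hC _ ε hε => ?_⟩
    obtain ⟨t, ht, hts⟩ := exists_chordalDist_lt_imp_sphDist_lt hε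
    filter_upwards [eventually_gt_atTop ⌈2 * (R + 1 / t)⌉₊] with i hi x hx
    have hxρ := ball_subset_closedBall (hC hx)
    apply hts
    rw [hGc _ x (hρr' hxρ)]
    have h1 : 2 * (R + 1 / t) < A (k (φ i)) := ((Nat.le_ceil _).trans_lt
      (Nat.cast_lt.2 hi)).trans_le (hφA i)
    have h2 := hdev (k (φ i)) x hxρ
    have h3 : A (k (φ i)) ≤ dist (G (k (φ i)) x) (G (k (φ i)) z) + ‖G (k (φ i)) x‖ + R := by
      calc A (k (φ i)) = ‖(G (k (φ i)) z - G (k (φ i)) x) + G (k (φ i)) x - p (k (φ i))‖ := by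
            rw [sub_add_cancel]
        _ ≤ ‖G (k (φ i)) z - G (k (φ i)) x‖ + ‖G (k (φ i)) x‖ + ‖p (k (φ i))‖ :=
            (norm_sub_le _ _).trans (by gcongr; exact norm_add_le _ _)
        _ ≤ _ := by rw [dist_comm, dist_eq_norm]; gcongr; exact (hpR _).le
    have h4 : 1 / t < ‖G (k (φ i)) x‖ := by linarith
    have h5 := norm_mul_chordalDist_infty_le (G (k (φ i)) x)
    rw [div_lt_iff₀ ht] at h4
    by_contra! hcon
    have h6 : 0 ≤ ‖G (k (φ i)) x‖ := norm_nonneg _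
    nlinarith
  · push Not at hcase
    obtain ⟨n, hn⟩ := hcase
    obtain ⟨i₀, hi₀⟩ := eventually_atTop.1 hn
    have hbdd : ∀ i, ∀ x ∈ closedBall z ρ, ‖G (k (i + i₀)) x‖ ≤ n + R + n / 2 := fun i x hx => by
      have hAn := hi₀ (i + i₀) (Nat.le_add_left _ _)
      have h2 := hdev (k (i + i₀)) x hx
      have h3 : ‖G (k (i + i₀)) x‖ ≤
          A (k (i + i₀)) + ‖p (k (i + i₀))‖ + dist (G (k (i + i₀)) x) (G (k (i + i₀)) z) := by
        calc ‖G (k (i + i₀)) x‖ = ‖(G (k (i + i₀)) z - p (k (i + i₀))) + p (k (i + i₀)) +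
              (G (k (i + i₀)) x - G (k (i + i₀)) z)‖ := by congr 1; ring
          _ ≤ _ := by rw [dist_eq_norm]; exact norm_add₃_le
      have := hpR (k (i + i₀))
      linarith
    have hlip' : ∀ i, ∀ x ∈ closedBall z ρ, ∀ y ∈ closedBall z ρ,
        dist (G (k (i + i₀)) x) (G (k (i + i₀)) y) ≤ L * n * dist x y := fun i x hx y hy => by
      refine (hlip _ x (hρr hx) y (hρr hy)).trans ?_
      gcongr
      exact (hi₀ (i + i₀) (Nat.le_add_left _ _)).le
    obtain ⟨φ, hφ, g, hg⟩ := exists_subseq_uniform_limit (fun i => G (k (i + i₀))) hbdd hlip'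
    refine ⟨fun i => φ i + i₀, fun a b hab => Nat.add_lt_add_right (hφ hab) _,
      fun x => g x, fun C hC _ ε hε => ?_⟩
    obtain ⟨t, ht, hts⟩ := exists_chordalDist_lt_imp_sphDist_lt hε
    filter_upwards [hg t ht] with i hi x hx
    have hxρ := ball_subset_closedBall (hC hx)
    apply hts
    rw [hGc _ x (hρr' hxρ)]
    refine (chordalDist_coe_le _ _).trans_lt ?_
    rw [← dist_eq_norm]
    exact hi x hxρ

end MeromorphicDynamics

namespace MeromorphicDynamics

open Metric MeasureTheory
open scoped ENNReal NNReal

/-! ### The dimension of self-similar sets -/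

section SelfSimilar

variable {ι : Type*} [Fintype ι] [Nontrivial ι] {Λ : Set ℂ} {φ : ι → ℂ → ℂ} {l : ι → ℝ≥0∞}
  {η : ℝ≥0∞} {d : ℝ}

/-- A bound for the `d`-dimensional content of a set `Λ` that contains its images under separated
maps `φ i`, which contract distances by no more than the factors `l i`. The proof is by induction on
the number of sets in a cover: sets that are small against the separation `η` meet only one of the
images, and the preimages under one of the maps form a cover with fewer members. -/
theorem le_sum_ediam_rpow (hd : 0 ≤ d) (hne : Λ.Nonempty) (hmaps : ∀ i, MapsTo (φ i) Λ Λ)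
    (hl : ∀ i, l i ≠ 0) (hl' : ∀ i, l i ≠ ⊤)
    (hexp : ∀ i, ∀ x ∈ Λ, ∀ y ∈ Λ, l i * edist x y ≤ edist (φ i x) (φ i y))
    (hsep : ∀ i j, i ≠ j → ∀ x ∈ Λ, ∀ y ∈ Λ, η ≤ edist (φ i x) (φ j y))
    (hsum : 1 ≤ ∑ i, l i ^ d) (s : Finset ℕ) (A : ℕ → Set ℂ) (hA : Λ ⊆ ⋃ k ∈ s, A k) :
    η ^ d ≤ ∑ k ∈ s, ediam (A k) ^ d := by
  classical
  induction s using Finset.strongInduction generalizing A with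
  | H s ih =>
  by_cases hbig : ∃ k ∈ s, η ≤ ediam (A k)
  · obtain ⟨k, hk, hkη⟩ := hbig
    exact (ENNReal.rpow_le_rpow hkη hd).trans
      (Finset.single_le_sum (f := fun k => ediam (A k) ^ d) (fun _ _ => zero_le) hk)
  push Not at hbig
  set T : ι → Finset ℕ := fun i => s.filter fun k => ∃ x ∈ Λ, φ i x ∈ A k with hT
  have hdisj : ∀ i j, i ≠ j → Disjoint (T i) (T j) := by
    intro i j hij
    rw [Finset.disjoint_left]
    intro k hki hkj
    obtain ⟨hks, x, hx, hxk⟩ := Finset.mem_filter.1 hki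
    obtain ⟨-, y, hy, hyk⟩ := Finset.mem_filter.1 hkj
    exact absurd ((hsep i j hij x hx y hy).trans (edist_le_ediam_of_mem hxk hyk))
      (not_le.2 (hbig k hks))
  have hTne : ∀ i, (T i).Nonempty := by
    intro i
    obtain ⟨x, hx⟩ := hne
    obtain ⟨k, hk, hxk⟩ := mem_iUnion₂.1 (hA (hmaps i hx))
    exact ⟨k, Finset.mem_filter.2 ⟨hk, x, hx, hxk⟩⟩
  have hTs : ∀ i, T i ⊂ s := by
    intro i
    obtain ⟨j, hj⟩ := exists_ne i
    obtain ⟨k, hk⟩ := hTne j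
    exact Finset.ssubset_iff_subset_ne.2 ⟨Finset.filter_subset _ _, fun h =>
      Finset.disjoint_left.1 (hdisj j i hj) hk (h ▸ (Finset.mem_filter.1 hk).1)⟩
  have hstep : ∀ i, l i ^ d * η ^ d ≤ ∑ k ∈ T i, ediam (A k) ^ d := by
    intro i
    have h1 := ih (T i) (hTs i) (fun k => {x ∈ Λ | φ i x ∈ A k}) (fun x hx => by
      obtain ⟨k, hk, hxk⟩ := mem_iUnion₂.1 (hA (hmaps i hx))
      exact mem_iUnion₂.2 ⟨k, Finset.mem_filter.2 ⟨hk, x, hx, hxk⟩, hx, hxk⟩)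
    refine (mul_le_mul_right h1 (l i ^ d)).trans ?_
    rw [Finset.mul_sum]
    refine Finset.sum_le_sum fun k _ => ?_
    rw [← ENNReal.mul_rpow_of_nonneg _ _ hd]
    refine ENNReal.rpow_le_rpow ?_ hd
    have h2 : ediam {x ∈ Λ | φ i x ∈ A k} ≤ ediam (A k) / l i := by
      refine ediam_le fun x hx y hy => ?_
      rw [ENNReal.le_div_iff_mul_le (Or.inl (hl i)) (Or.inl (hl' i)), mul_comm]
      exact (hexp i x hx.1 y hy.1).trans (edist_le_ediam_of_mem hx.2 hy.2)
    rw [ENNReal.le_div_iff_mul_le (Or.inl (hl i)) (Or.inl (hl' i)), mul_comm] at h2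
    exact h2
  calc η ^ d ≤ (∑ i, l i ^ d) * η ^ d := le_mul_of_one_le_left' hsum
    _ = ∑ i, l i ^ d * η ^ d := Finset.sum_mul _ _ _
    _ ≤ ∑ i, ∑ k ∈ T i, ediam (A k) ^ d := Finset.sum_le_sum fun i _ => hstep i
    _ = ∑ k ∈ Finset.univ.biUnion T, ediam (A k) ^ d :=
        (Finset.sum_biUnion fun i _ j _ hij => hdisj i j hij).symm
    _ ≤ ∑ k ∈ s, ediam (A k) ^ d := Finset.sum_le_sum_of_subset
        (Finset.biUnion_subset.2 fun i _ => Finset.filter_subset _ _)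

/-- A compact set has Hausdorff dimension at least `d` if its finite covers have `d`-dimensional
content bounded below. -/
theorem le_dimH_of_forall_finite_cover {d : ℝ≥0} (hd : 0 < d) (hΛ : IsCompact Λ) {c : ℝ≥0∞}
    (hc : c ≠ 0) (hcover : ∀ (s : Finset ℕ) (A : ℕ → Set ℂ), Λ ⊆ ⋃ k ∈ s, A k →
      c ≤ ∑ k ∈ s, ediam (A k) ^ (d : ℝ)) : (d : ℝ≥0∞) ≤ dimH Λ := by
  by_contra! hlt
  have hd' : (0 : ℝ) < d := hd
  have h0 := hausdorffMeasure_of_dimH_lt hlt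
  have hinf : ⨅ (t : ℕ → Set ℂ) (_ : Λ ⊆ ⋃ n, t n) (_ : ∀ n, ediam (t n) ≤ 1),
      ∑' n, ⨆ _ : (t n).Nonempty, ediam (t n) ^ (d : ℝ) < c := by
    refine lt_of_le_of_lt ?_ (pos_iff_ne_zero.2 hc)
    rw [← h0, Measure.hausdorffMeasure_apply]
    exact le_iSup₂_of_le (1 : ℝ≥0∞) one_pos le_rfl
  simp only [iInf_lt_iff] at hinf
  obtain ⟨t, ht, ht1, htc⟩ := hinf
  have hval : ∀ n, ⨆ _ : (t n).Nonempty, ediam (t n) ^ (d : ℝ) = ediam (t n) ^ (d : ℝ) := by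
    intro n
    rcases (t n).eq_empty_or_nonempty with h | h
    · simp [h, hd']
    · simp [h]
  simp only [hval] at htc
  obtain ⟨e, he, hesum⟩ := ENNReal.exists_pos_sum_of_countable' (tsub_pos_of_lt htc).ne' ℕ
  -- Slightly larger open sets still have small content.
  have hopen : ∀ n, ∃ δ : ℝ≥0, 0 < δ ∧
      ediam (thickening δ (t n)) ^ (d : ℝ) ≤ ediam (t n) ^ (d : ℝ) + e n := by
    intro n
    have htop : ediam (t n) ≠ ⊤ := ((ht1 n).trans_lt ENNReal.one_lt_top).ne
    have hcont : Tendsto (fun δ : ℝ≥0 => (ediam (t n) + 2 * (δ : ℝ≥0∞)) ^ (d : ℝ)) (𝓝[>] 0)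
        (𝓝 (ediam (t n) ^ (d : ℝ))) := by
      have : Tendsto (fun δ : ℝ≥0 => (ediam (t n) + 2 * (δ : ℝ≥0∞)) ^ (d : ℝ)) (𝓝 0)
          (𝓝 ((ediam (t n) + 2 * ((0 : ℝ≥0) : ℝ≥0∞)) ^ (d : ℝ))) := by
        refine (ENNReal.continuous_rpow_const.tendsto _).comp (tendsto_const_nhds.add ?_)
        exact ENNReal.Tendsto.const_mul (ENNReal.tendsto_coe.2 tendsto_id) (Or.inr (by simp))
      simp only [ENNReal.coe_zero, mul_zero, add_zero] at this
      exact this.mono_left nhdsWithin_le_nhds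
    have hlt' : ediam (t n) ^ (d : ℝ) < ediam (t n) ^ (d : ℝ) + e n :=
      ENNReal.lt_add_right (ENNReal.rpow_ne_top_of_nonneg hd'.le htop) (he n).ne'
    obtain ⟨δ, hδ, hδ0⟩ := ((hcont.eventually (gt_mem_nhds hlt')).and self_mem_nhdsWithin).exists
    exact ⟨δ, hδ0, (ENNReal.rpow_le_rpow (ediam_thickening_le δ) hd'.le).trans hδ.le⟩
  choose δ hδ0 hδ using hopen
  obtain ⟨s, hs⟩ := hΛ.elim_finite_subcover (fun n => thickening (δ n) (t n))
    (fun n => isOpen_thickening)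
    (ht.trans (iUnion_mono fun n => self_subset_thickening (hδ0 n) _))
  have hcontra := calc
    c ≤ ∑ k ∈ s, ediam (thickening (δ k) (t k)) ^ (d : ℝ) := hcover s _ hs
    _ ≤ ∑ k ∈ s, (ediam (t k) ^ (d : ℝ) + e k) := Finset.sum_le_sum fun k _ => hδ k
    _ ≤ ∑' k, (ediam (t k) ^ (d : ℝ) + e k) := ENNReal.sum_le_tsum s
    _ = ∑' k, ediam (t k) ^ (d : ℝ) + ∑' k, e k := ENNReal.tsum_add
    _ < ∑' k, ediam (t k) ^ (d : ℝ) + (c - ∑' k, ediam (t k) ^ (d : ℝ)) :=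
        ENNReal.add_lt_add_left (ne_top_of_lt htc) hesum
    _ = c := add_tsub_cancel_of_le htc.le
  exact lt_irrefl _ hcontra

end SelfSimilar

/-- The limit set of a finite system of contractions of a compact set: the points that start a
sequence in which each member is the image of the next. -/
theorem exists_compact_limitSet {ι : Type*} [Finite ι] [Nonempty ι] {φ : ι → ℂ → ℂ} {D : Set ℂ} (hD : IsCompact D)
    (hne : D.Nonempty) (hmaps : ∀ i, MapsTo (φ i) D D) {κ : ℝ≥0} (hκ : κ < 1)
    (hlip : ∀ i, LipschitzOnWith κ (φ i) D) :
    ∃ Λ ⊆ D, IsCompact Λ ∧ Λ.Nonempty ∧ (∀ i, MapsTo (φ i) Λ Λ) ∧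
      ∀ x ∈ Λ, ∃ i, ∃ y ∈ Λ, φ i y = x := by
  set P : Set (ℕ → ℂ) := univ.pi fun _ => D with hP
  have hPc : IsCompact P := isCompact_univ_pi fun _ => hD
  set S : Set (ℕ → ℂ) := ⋂ k, ⋃ i, P ∩ {u | u k = φ i (u (k + 1))} with hS
  have hSmem : ∀ u, u ∈ S ↔ ∀ k, u k ∈ D ∧ ∃ i, u k = φ i (u (k + 1)) := by
    intro u
    simp only [hS, hP, mem_iInter, mem_iUnion, mem_inter_iff, mem_univ_pi, mem_ofPred_eq]
    exact ⟨fun h k => ⟨(h k).choose_spec.1 k, (h k).choose, (h k).choose_spec.2⟩,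
      fun h k => ⟨(h k).2.choose, fun j => (h j).1, (h k).2.choose_spec⟩⟩
  have hSc : IsClosed S := by
    refine isClosed_iInter fun k => isClosed_iUnion_of_finite fun i => ?_
    have h1 : ContinuousOn (fun u : ℕ → ℂ => (u k, φ i (u (k + 1)))) P :=
      (continuous_apply k).continuousOn.prodMk ((hlip i).continuousOn.comp
        (continuous_apply (k + 1)).continuousOn fun u hu => hu (k + 1) (mem_univ _))
    exact h1.preimage_isClosed_of_isClosed hPc.isClosed isClosed_diagonal
  have hSP : S ⊆ P := fun u hu k _ => ((hSmem u).1 hu k).1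
  refine ⟨(fun u => u 0) '' S, ?_, (hPc.of_isClosed_subset hSc hSP).image (continuous_apply 0),
    ?_, ?_, ?_⟩
  · rintro _ ⟨u, hu, rfl⟩
    exact hSP hu 0 (mem_univ _)
  · obtain ⟨x, hx⟩ := hne
    let i : ι := Classical.arbitrary ι
    obtain ⟨y, hyD, hy, -⟩ := ContractingWith.exists_fixedPoint' (K := κ) hD.isComplete (hmaps i)
      ⟨hκ, (hlip i).mapsToRestrict (hmaps i)⟩ hx (edist_ne_top _ _)
    exact ⟨y, fun _ => y, (hSmem _).2 fun k => ⟨hyD, i, hy.symm⟩, rfl⟩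
  · rintro i _ ⟨u, hu, rfl⟩
    refine ⟨fun k => Nat.casesOn k (φ i (u 0)) u, (hSmem _).2 fun k => ?_, rfl⟩
    rcases k with _ | k
    · exact ⟨hmaps i (hSP hu 0 (mem_univ _)), i, rfl⟩
    · exact (hSmem u).1 hu k
  · rintro _ ⟨u, hu, rfl⟩
    obtain ⟨-, i, hi⟩ := (hSmem u).1 hu 0
    exact ⟨i, u 1, ⟨fun k => u (k + 1), (hSmem _).2 fun k => (hSmem u).1 hu (k + 1), rfl⟩, hi.symm⟩

end MeromorphicDynamics

namespace MeromorphicDynamics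

open Metric MeasureTheory
open scoped ENNReal NNReal

/-! ### Hyperbolic sets from finitely many inverse branches -/

variable {f : ℂ → OnePoint ℂ}

/-- On a set along which the derivative of `f` is bounded by `M`, the derivatives of the iterates
grow at most exponentially, and similarly for lower bounds. -/
theorem norm_iterDeriv_bounds (hf : ∀ z, HolomorphicAt f z) {K : Set ℂ}
    (hK : ∀ z ∈ K, ∃ w ∈ K, f z = (w : OnePoint ℂ)) {m M : ℝ} (hm : 0 ≤ m)
    (hb : ∀ z ∈ K, m ≤ ‖iterDeriv f 1 z‖ ∧ ‖iterDeriv f 1 z‖ ≤ M) (n : ℕ) :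
    ∀ z ∈ K, m ^ n ≤ ‖iterDeriv f n z‖ ∧ ‖iterDeriv f n z‖ ≤ M ^ n := by
  induction n with
  | zero =>
    intro z _
    have : iterDeriv f 0 z = 1 := (hasDerivAt_id z).deriv
    simp [this]
  | succ n ih =>
    intro z hz
    obtain ⟨w, hw, h⟩ := exists_iter_eq_of_forwardInvariant hK n hz
    have hfin : iter f 1 w ≠ (∞ : OnePoint ℂ) := by
      obtain ⟨v, -, h'⟩ := hK w hw
      rw [iter_one, h']
      exact OnePoint.coe_ne_infty v
    rw [iterDeriv_add hf h hfin, norm_mul, pow_succ, pow_succ, mul_comm (m ^ n), mul_comm (M ^ n)]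
    have hM : 0 ≤ M := (norm_nonneg _).trans (hb w hw).2
    exact ⟨mul_le_mul (hb w hw).1 (ih z hz).1 (by positivity) (norm_nonneg _),
      mul_le_mul (hb w hw).2 (ih z hz).2 (norm_nonneg _) hM⟩

/-- The limit set of finitely many contracting inverse branches of iterates lies in a hyperbolic
set, namely in the union of its images under the intermediate iterates. -/
theorem exists_isHyperbolicSet_of_branches (hf : ∀ z, HolomorphicAt f z) {ι : Type*} [Finite ι]
    {n : ι → ℕ} (hn : ∀ i, 1 ≤ n i) {φ : ι → ℂ → ℂ} {Λ Ω : Set ℂ} (hΛ : IsCompact Λ)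
    (hΩ : IsOpen Ω) (hΛΩ : Λ ⊆ Ω) (hmaps : ∀ i, MapsTo (φ i) Λ Λ)
    (hcov : ∀ x ∈ Λ, ∃ i, ∃ y ∈ Λ, φ i y = x) (hd : ∀ i, DifferentiableOn ℂ (φ i) Ω)
    (hinv : ∀ i, ∀ x ∈ Ω, φ i x ∈ iterDomain f (n i) ∧ iter f (n i) (φ i x) = x)
    (hlip : ∀ i, ∀ x ∈ Ω, ∀ y ∈ Ω, dist (φ i x) (φ i y) ≤ 1 / 2 * dist x y) :
    ∃ K, IsHyperbolicSet f K ∧ Λ ⊆ K := by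
  have hfin : ∀ i, ∀ x ∈ Ω, ∀ k ≤ n i, iter f k (φ i x) ≠ (∞ : OnePoint ℂ) := fun i x hx k hk =>
    iter_ne_infty_of_le hk ((hinv i x hx).2 ▸ OnePoint.coe_ne_infty x)
  have hderiv2 : ∀ i, ∀ x ∈ Λ, 2 ≤ ‖iterDeriv f (n i) (φ i x)‖ := by
    intro i x hx
    have hxΩ := hΛΩ hx
    have h1 : HasDerivAt (φ i) (deriv (φ i) x) x :=
      ((hd i).differentiableAt (hΩ.mem_nhds hxΩ)).hasDerivAt
    have h2 := (analyticAt_finitePart_iter hf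
      (hfin i x hxΩ (n i) le_rfl)).differentiableAt.hasDerivAt.comp x h1
    have h3 : HasDerivAt ((finitePart ∘ iter f (n i)) ∘ φ i) 1 x := by
      refine (hasDerivAt_id x).congr_of_eventuallyEq ?_
      filter_upwards [hΩ.mem_nhds hxΩ] with y hy
      simp [(hinv i y hy).2]
    have h4 := congrArg norm (h2.unique h3)
    rw [norm_mul, norm_one] at h4
    have h5 : ‖deriv (φ i) x‖ ≤ 1 / 2 := by
      refine norm_deriv_le_of_lip' (by norm_num) ?_
      filter_upwards [hΩ.mem_nhds hxΩ] with y hy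
      rw [← dist_eq_norm, ← dist_eq_norm]
      exact hlip i y hy x hxΩ
    rw [iterDeriv_eq]
    nlinarith [norm_nonneg (deriv (finitePart ∘ iter f (n i)) (φ i x))]
  set K : Set ℂ := ⋃ i, ⋃ k ∈ Finset.range (n i), (fun x => finitePart (iter f k (φ i x))) '' Λ
    with hKdef
  have hKmem : ∀ y, y ∈ K ↔ ∃ i, ∃ k < n i, ∃ x ∈ Λ, iter f k (φ i x) = y := by
    intro y
    simp only [hKdef, mem_iUnion, Finset.mem_range, mem_image, exists_prop]
    constructor
    · rintro ⟨i, k, hk, x, hx, rfl⟩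
      exact ⟨i, k, hk, x, hx, iter_eq_coe (hfin i x (hΛΩ hx) k hk.le)⟩
    · rintro ⟨i, k, hk, x, hx, h⟩
      exact ⟨i, k, hk, x, hx, by rw [h, finitePart_coe]⟩
  have hKc : IsCompact K := by
    refine isCompact_iUnion fun i => (Finset.range (n i)).isCompact_biUnion fun k hk => ?_
    refine hΛ.image_of_continuousOn fun x hx => ContinuousAt.continuousWithinAt ?_
    exact ContinuousAt.comp (g := finitePart ∘ iter f k) (analyticAt_finitePart_iter hf
      (hfin i x (hΛΩ hx) k (Finset.mem_range.1 hk).le)).continuousAt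
      ((hd i).differentiableAt (hΩ.mem_nhds (hΛΩ hx))).continuousAt
  have hΛK : Λ ⊆ K := by
    intro x hx
    obtain ⟨i, y, hy, rfl⟩ := hcov x hx
    exact (hKmem _).2 ⟨i, 0, hn i, y, hy, rfl⟩
  have hKf : ∀ y ∈ K, ∃ w ∈ K, f y = (w : OnePoint ℂ) := by
    intro y hy
    obtain ⟨i, k, hk, x, hx, h⟩ := (hKmem y).1 hy
    rw [← iter_succ_of_eq h]
    rcases Nat.lt_or_ge (k + 1) (n i) with hlt | hge
    · exact ⟨finitePart (iter f (k + 1) (φ i x)), (hKmem _).2 ⟨i, k + 1, hlt, x, hx,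
        iter_eq_coe (hfin i x (hΛΩ hx) _ hlt.le)⟩, iter_eq_coe (hfin i x (hΛΩ hx) _ hlt.le)⟩
    · have : k + 1 = n i := by omega
      rw [this, (hinv i x (hΛΩ hx)).2]
      exact ⟨x, hΛK hx, rfl⟩
  have hit : ∀ n, ∀ z ∈ K, iter f n z ≠ (∞ : OnePoint ℂ) := by
    intro n z hz
    obtain ⟨w, -, h⟩ := exists_iter_eq_of_forwardInvariant hKf n hz
    exact h ▸ OnePoint.coe_ne_infty w
  have hne : ∀ y ∈ K, iterDeriv f 1 y ≠ 0 := by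
    intro y hy h0
    obtain ⟨i, k, hk, x, hx, h⟩ := (hKmem y).1 hy
    obtain ⟨w, hw, hyw⟩ := hKf y hy
    have h1 : iterDeriv f (1 + (n i - k - 1)) y = 0 := by
      rw [iterDeriv_add hf (w := w) (by rw [iter_one, hyw]) (hit _ w hw), h0, mul_zero]
    have h2 : iterDeriv f (k + (1 + (n i - k - 1))) (φ i x) = 0 := by
      rw [iterDeriv_add hf h (hit _ y hy), h1, zero_mul]
    rw [show k + (1 + (n i - k - 1)) = n i by omega] at h2
    have := hderiv2 i x hx
    rw [h2, norm_zero] at this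
    linarith
  have hcontd : ContinuousOn (iterDeriv f 1) K := fun y hy =>
    (analyticAt_finitePart_iter hf (hit 1 y hy)).deriv.continuousAt.continuousWithinAt
  obtain ⟨M, hM⟩ := hKc.exists_bound_of_continuousOn hcontd
  obtain ⟨m', hm'⟩ := hKc.exists_bound_of_continuousOn (hcontd.inv₀ hne)
  set m : ℝ := 1 / max m' 1 with hmdef
  have hm'1 : (1 : ℝ) ≤ max m' 1 := le_max_right _ _
  have hm0 : 0 < m := by positivity
  have hm1 : m ≤ 1 := by rw [hmdef, div_le_one (by positivity)]; exact hm'1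
  have hM1 : (1 : ℝ) ≤ max M 1 := le_max_right _ _
  have hb : ∀ z ∈ K, m ≤ ‖iterDeriv f 1 z‖ ∧ ‖iterDeriv f 1 z‖ ≤ max M 1 := by
    intro z hz
    refine ⟨?_, (hM z hz).trans (le_max_left _ _)⟩
    have h1 : ‖iterDeriv f 1 z‖⁻¹ ≤ max m' 1 := by
      rw [← norm_inv]; exact (hm' z hz).trans (le_max_left _ _)
    have h2 : 0 < ‖iterDeriv f 1 z‖ := norm_pos_iff.2 (hne z hz)
    rw [hmdef, one_div]
    exact inv_le_of_inv_le₀ h2 h1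
  have hbn := norm_iterDeriv_bounds hf hKf hm0.le hb
  obtain ⟨N, hN⟩ : ∃ N ≥ 1, ∀ i, n i ≤ N := by
    obtain ⟨N, hN⟩ := (Set.finite_range n).bddAbove
    exact ⟨N + 1, Nat.le_add_left 1 N, fun i => (hN ⟨i, rfl⟩).trans (Nat.le_succ N)⟩
  obtain ⟨hN1, hN⟩ := hN
  set γ : ℝ := 2 ^ ((N : ℝ)⁻¹) with hγ
  have hγ1 : 1 < γ := Real.one_lt_rpow one_lt_two (by positivity)
  have hγN : γ ^ N = 2 := by
    rw [hγ, ← Real.rpow_natCast, ← Real.rpow_mul zero_le_two,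
      inv_mul_cancel₀ (by positivity), Real.rpow_one]
  -- Along `Λ` the derivative at least doubles whenever a full branch has been traversed.
  have hlow : ∀ p, ∀ x ∈ Λ, m ^ N / 2 * γ ^ p ≤ ‖iterDeriv f p x‖ := by
    intro p
    induction p using Nat.strong_induction_on with
    | _ p ih =>
      intro x hx
      obtain ⟨i, y, hy, rfl⟩ := hcov x hx
      rcases Nat.lt_or_ge p (n i) with hlt | hge
      · have hpN : p ≤ N := hlt.le.trans (hN i)
        calc m ^ N / 2 * γ ^ p ≤ m ^ N / 2 * γ ^ N := by gcongr; exact hγ1.le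
          _ = m ^ N := by rw [hγN]; ring
          _ ≤ m ^ p := pow_le_pow_of_le_one hm0.le hm1 hpN
          _ ≤ _ := (hbn p _ (hΛK hx)).1
      · obtain ⟨q, rfl⟩ := Nat.exists_eq_add_of_le hge
        have h1 := ih q (by have := hn i; omega) y hy
        have h2 := hderiv2 i y hy
        rw [iterDeriv_add hf (hinv i y (hΛΩ hy)).2 (hit q y (hΛK hy)), norm_mul, pow_add]
        have h3 : γ ^ n i ≤ 2 := hγN ▸ pow_le_pow_right₀ hγ1.le (hN i)
        calc m ^ N / 2 * (γ ^ n i * γ ^ q) = (m ^ N / 2 * γ ^ q) * γ ^ n i := by ring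
          _ ≤ ‖iterDeriv f q y‖ * ‖iterDeriv f (n i) (φ i y)‖ := by
            gcongr
            exact h3.trans h2
  refine ⟨K, ⟨hKc, hKf, m ^ N / 2 / max M 1 ^ N, by positivity, γ, hγ1, fun p _ y hy => ?_⟩, hΛK⟩
  obtain ⟨i, k, hk, x, hx, h⟩ := (hKmem y).1 hy
  have h1 := hlow (k + p) (φ i x) (hmaps i hx)
  rw [iterDeriv_add hf h (hit p y hy), norm_mul] at h1
  have h2 : ‖iterDeriv f k (φ i x)‖ ≤ max M 1 ^ N :=
    (hbn k _ (hΛK (hmaps i hx))).2.trans (pow_le_pow_right₀ hM1 (hk.le.trans (hN i)))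
  rw [div_mul_eq_mul_div, div_le_iff₀ (by positivity)]
  calc m ^ N / 2 * γ ^ p ≤ m ^ N / 2 * γ ^ (k + p) := by
        gcongr
        · exact hγ1.le
        · omega
    _ ≤ _ := h1
    _ ≤ _ := by gcongr

/-- The points `z` that are approached by images of the disk `D(a, s)` under univalent inverse
branches `φ` of iterates, whose distortion is bounded by `C`: the image lies within distance `l` of
`z`, and `φ` changes distances by the factor `l`, up to the constant `C`. -/
def branchSet (f : ℂ → OnePoint ℂ) (a : ℂ) (s C : ℝ) : Set ℂ :=
  {z | ∀ ε > 0, ∃ n : ℕ, 1 ≤ n ∧ ∃ (φ : ℂ → ℂ) (l : ℝ), 0 < l ∧ l < ε ∧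
    DifferentiableOn ℂ φ (ball a s) ∧
    (∀ x ∈ ball a s, φ x ∈ iterDomain f n ∧ iter f n (φ x) = x ∧ dist (φ x) z < l) ∧
    ∀ x ∈ ball a s, ∀ y ∈ ball a s,
      l * dist x y ≤ C * dist (φ x) (φ y) ∧ dist (φ x) (φ y) ≤ C * l * dist x y}

theorem exists_pos_le_edist_of_pairwise_disjoint {ι : Type*} [Finite ι] {A : ι → Set ℂ}
    (hA : ∀ i, IsCompact (A i)) (hdisj : ∀ i j, i ≠ j → Disjoint (A i) (A j)) :
    ∃ η : ℝ≥0, 0 < η ∧ ∀ i j, i ≠ j → ∀ x ∈ A i, ∀ y ∈ A j, (η : ℝ≥0∞) ≤ edist x y := by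
  have hev : ∀ᶠ η : ℝ≥0 in 𝓝[>] 0, ∀ i j, i ≠ j → ∀ x ∈ A i, ∀ y ∈ A j,
      (η : ℝ≥0∞) ≤ edist x y := by
    refine eventually_all.2 fun i => eventually_all.2 fun j => ?_
    by_cases hij : i = j
    · exact Eventually.of_forall fun _ h => absurd hij h
    obtain ⟨r, hr, hrd⟩ := exists_pos_forall_lt_edist (hA i) (hA j).isClosed (hdisj i j hij)
    filter_upwards [nhdsWithin_le_nhds (gt_mem_nhds hr)] with η hη _ x hx y hy
    exact (ENNReal.coe_le_coe.2 (le_of_lt hη)).trans (hrd x hx y hy).le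
  obtain ⟨η, h1, h2⟩ := (hev.and self_mem_nhdsWithin).exists
  exact ⟨η, h2, h1⟩

/-- Finitely many inverse branches that map a disk into disjoint disks inside it, and whose
contraction ratios are large enough, generate a hyperbolic set of dimension at least `d`. -/
theorem le_hyperbolicDim_of_branches (hf : ∀ z, HolomorphicAt f z) {ι : Type*} [Fintype ι]
    [Nontrivial ι] {a : ℂ} {s C : ℝ} {d : ℝ≥0} (hd : 0 < d) (hC : 0 < C) {n : ι → ℕ}
    (hn : ∀ i, 1 ≤ n i) {φ : ι → ℂ → ℂ} {c : ι → ℂ} {l : ι → ℝ} (hl : ∀ i, 0 < l i)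
    (hlC : ∀ i, C * l i ≤ 1 / 2) (hball : ∀ i, closedBall (c i) (l i) ⊆ ball a s)
    (hdisj : ∀ i j, i ≠ j → Disjoint (closedBall (c i) (l i)) (closedBall (c j) (l j)))
    (hφ : ∀ i, DifferentiableOn ℂ (φ i) (ball a s))
    (hinv : ∀ i, ∀ x ∈ ball a s,
      φ i x ∈ iterDomain f (n i) ∧ iter f (n i) (φ i x) = x ∧ dist (φ i x) (c i) < l i)
    (hlip : ∀ i, ∀ x ∈ ball a s, ∀ y ∈ ball a s,
      l i * dist x y ≤ C * dist (φ i x) (φ i y) ∧ dist (φ i x) (φ i y) ≤ C * l i * dist x y)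
    (hsum : 1 ≤ ∑ i, ENNReal.ofReal (l i / C) ^ (d : ℝ)) : (d : ℝ≥0∞) ≤ hyperbolicDim f := by
  set D : Set ℂ := ⋃ i, closedBall (c i) (l i) with hD
  have hDc : IsCompact D := isCompact_iUnion fun i => isCompact_closedBall _ _
  have hDb : D ⊆ ball a s := iUnion_subset hball
  have hDne : D.Nonempty := by
    obtain ⟨i, -, -⟩ := exists_pair_ne ι
    exact ⟨c i, mem_iUnion.2 ⟨i, mem_closedBall_self (hl i).le⟩⟩
  have hhalf : ∀ i, ∀ x ∈ ball a s, ∀ y ∈ ball a s,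
      dist (φ i x) (φ i y) ≤ 1 / 2 * dist x y := fun i x hx y hy =>
    (hlip i x hx y hy).2.trans (by gcongr; exact hlC i)
  have hφball : ∀ i, ∀ x ∈ ball a s, φ i x ∈ closedBall (c i) (l i) := fun i x hx =>
    (hinv i x hx).2.2.le
  obtain ⟨Λ, hΛD, hΛc, hΛne, hΛm, hΛcov⟩ := exists_compact_limitSet (φ := φ) hDc hDne
    (fun i x hx => mem_iUnion.2 ⟨i, hφball i x (hDb hx)⟩) (κ := 1 / 2)
    (by rw [← NNReal.coe_lt_coe]; norm_num)
    (fun i => LipschitzOnWith.of_dist_le_mul fun x hx y hy => by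
      simpa using hhalf i x (hDb hx) y (hDb hy))
  obtain ⟨K, hK, hΛK⟩ := exists_isHyperbolicSet_of_branches hf hn hΛc isOpen_ball (hΛD.trans hDb)
    hΛm hΛcov hφ (fun i x hx => ⟨(hinv i x hx).1, (hinv i x hx).2.1⟩) hhalf
  obtain ⟨η, hη, hsep⟩ := exists_pos_le_edist_of_pairwise_disjoint
    (fun i => isCompact_closedBall (c i) (l i)) hdisj
  have hdim : (d : ℝ≥0∞) ≤ dimH Λ := by
    refine le_dimH_of_forall_finite_cover hd hΛc (c := (η : ℝ≥0∞) ^ (d : ℝ)) ?_ fun t A hA => ?_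
    · exact (ENNReal.rpow_pos (ENNReal.coe_pos.2 hη) ENNReal.coe_ne_top).ne'
    · refine le_sum_ediam_rpow (φ := φ) (l := fun i => ENNReal.ofReal (l i / C)) d.coe_nonneg
        hΛne hΛm (fun i => ?_) (fun i => ENNReal.ofReal_ne_top) (fun i x hx y hy => ?_)
        (fun i j hij x hx y hy => hsep i j hij _ (hφball i x (hDb (hΛD hx))) _
          (hφball j y (hDb (hΛD hy)))) hsum t A hA
      · exact (ENNReal.ofReal_pos.2 (div_pos (hl i) hC)).ne'
      · rw [edist_dist, edist_dist, ← ENNReal.ofReal_mul (div_pos (hl i) hC).le]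
        refine ENNReal.ofReal_le_ofReal ?_
        rw [div_mul_eq_mul_div, div_le_iff₀ hC, mul_comm _ C]
        exact (hlip i x (hDb (hΛD hx)) y (hDb (hΛD hy))).1
  exact (hdim.trans (dimH_mono hΛK)).trans (le_iSup₂ (f := fun K _ => dimH K) K hK)

/-- Vitali's covering lemma selects disjoint disks from those given by the definition of
`branchSet`; if the dimension of the set exceeds `d`, the sum of the `d`-th powers of their radii is
as large as desired, and finitely many of the branches generate a hyperbolic set. -/
theorem dimH_branchSet_inter_ball_le (hf : ∀ z, HolomorphicAt f z) (a : ℂ) (s : ℝ) {C : ℝ}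
    (hC : 1 ≤ C) : dimH (branchSet f a s C ∩ ball a s) ≤ hyperbolicDim f := by
  have hC0 : 0 < C := one_pos.trans_le hC
  refine ENNReal.le_of_forall_nnreal_lt fun d hd => ?_
  rcases eq_or_lt_of_le (zero_le (a := d)) with rfl | hd0
  · simp
  have hd0' : (0 : ℝ) < d := hd0
  set E := branchSet f a s C ∩ ball a s with hE
  have hinf := hausdorffMeasure_of_lt_dimH hd
  by_contra! hcon
  have hfam : ∀ j : ℕ, ∃ (l : ℂ → ℝ) (u : Set ℂ), u.Countable ∧
      (∀ z ∈ u, 0 < l z ∧ l z ≤ 1 / ((j : ℝ) + 1)) ∧ (E ⊆ ⋃ z ∈ u, closedBall z (5 * l z)) ∧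
      ∀ F : Finset ℂ, (F : Set ℂ) ⊆ u → ∑ z ∈ F, ENNReal.ofReal (l z / C) ^ (d : ℝ) ≤ 1 := by
    intro j
    have hdata : ∀ z ∈ E, ∃ (n : ℕ) (φ : ℂ → ℂ) (l : ℝ), 1 ≤ n ∧ 0 < l ∧
        l < min (min (1 / ((j : ℝ) + 1)) (1 / (2 * C))) (s - dist z a) ∧
        DifferentiableOn ℂ φ (ball a s) ∧
        (∀ x ∈ ball a s, φ x ∈ iterDomain f n ∧ iter f n (φ x) = x ∧ dist (φ x) z < l) ∧
        ∀ x ∈ ball a s, ∀ y ∈ ball a s,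
          l * dist x y ≤ C * dist (φ x) (φ y) ∧ dist (φ x) (φ y) ≤ C * l * dist x y := by
      intro z hz
      have hzs : 0 < s - dist z a := sub_pos.2 hz.2
      obtain ⟨n, hn, φ, l, h⟩ := hz.1 (min (min (1 / ((j : ℝ) + 1)) (1 / (2 * C))) (s - dist z a))
        (by positivity)
      exact ⟨n, φ, l, hn, h⟩
    choose! n φ l hn hl hlt hφ hinv hlip using hdata
    have hl1 : ∀ z ∈ E, l z ≤ 1 / ((j : ℝ) + 1) := fun z hz =>
      ((hlt z hz).trans_le ((min_le_left _ _).trans (min_le_left _ _))).le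
    have hl2 : ∀ z ∈ E, C * l z ≤ 1 / 2 := fun z hz => by
      have := ((hlt z hz).trans_le ((min_le_left _ _).trans (min_le_right _ _))).le
      calc C * l z ≤ C * (1 / (2 * C)) := by gcongr
        _ = 1 / 2 := by field_simp
    have hl3 : ∀ z ∈ E, closedBall z (l z) ⊆ ball a s := fun z hz =>
      closedBall_subset_ball' (by
        have := (hlt z hz).trans_le (min_le_right _ _)
        linarith)
    obtain ⟨u, huE, hudisj, hucov⟩ := Vitali.exists_disjoint_subfamily_covering_enlargement_closedBall
      E (fun z => z) l (1 / ((j : ℝ) + 1)) hl1 5 (by norm_num)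
    refine ⟨l, u, hudisj.countable_of_nonempty_interior fun z hz => ?_,
      fun z hz => ⟨hl z (huE hz), hl1 z (huE hz)⟩, fun z hz => ?_, fun F hF => ?_⟩
    · exact ⟨z, ball_subset_interior_closedBall (mem_ball_self (hl z (huE hz)))⟩
    · obtain ⟨w, hw, hzw⟩ := hucov z hz
      exact mem_iUnion₂.2 ⟨w, hw, hzw (mem_closedBall_self (hl z hz).le)⟩
    · by_contra! hbig
      have hle1 : ∀ z ∈ E, ENNReal.ofReal (l z / C) ^ (d : ℝ) ≤ 1 := fun z hz => by
        refine ENNReal.rpow_le_one (ENNReal.ofReal_le_one.2 ?_) hd0'.le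
        rw [div_le_one hC0]
        nlinarith [hl2 z hz, hl z hz]
      -- A single branch has contraction ratio less than one and would not suffice.
      have hnt : Nontrivial F := by
        by_contra hsub
        rw [not_nontrivial_iff_subsingleton, ← Finset.card_le_one_iff_subsingleton_coe] at hsub
        refine absurd hbig (not_lt.2 ?_)
        calc ∑ z ∈ F, ENNReal.ofReal (l z / C) ^ (d : ℝ) ≤ ∑ z ∈ F, 1 :=
              Finset.sum_le_sum fun z hz => hle1 z (huE (hF hz))
          _ ≤ 1 := by simpa using hsub
      have hFE : ∀ i : F, (i : ℂ) ∈ E := fun i => huE (hF i.2)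
      refine absurd (le_hyperbolicDim_of_branches hf (ι := F) (a := a) (s := s) hd0 hC0
        (n := fun i => n i) (fun i => hn i (hFE i)) (φ := fun i => φ i) (c := fun i => i)
        (l := fun i => l i) (fun i => hl i (hFE i)) (fun i => hl2 i (hFE i))
        (fun i => hl3 i (hFE i)) (fun i k hik => hudisj (hF i.2) (hF k.2) fun h => hik (Subtype.ext h))
        (fun i => hφ i (hFE i)) (fun i => hinv i (hFE i)) (fun i => hlip i (hFE i)) ?_) (not_le.2 hcon)
      rw [Finset.sum_coe_sort F fun z => ENNReal.ofReal (l z / C) ^ (d : ℝ)]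
      exact hbig.le
  choose l u hu hl hcov hF using hfam
  have hcount : ∀ j, Countable (u j) := fun j => (hu j).to_subtype
  set T : ℝ≥0∞ := ENNReal.ofReal (10 * C) ^ (d : ℝ) with hT
  have hdiam : ∀ j, ∀ z ∈ u j, ediam (closedBall z (5 * l j z)) ≤
      ENNReal.ofReal (10 * C) * ENNReal.ofReal (l j z / C) := by
    intro j z hz
    rw [← ENNReal.ofReal_mul (by positivity),
      show 10 * C * (l j z / C) = 2 * (5 * l j z) by field_simp; ring,
      ENNReal.ofReal_mul zero_le_two, ← Metric.closedEBall_ofReal (by linarith [(hl j z hz).1])]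
    simpa using Metric.ediam_closedEBall_le
  have htsum : ∀ j, ∑' z : u j, ediam (closedBall (z : ℂ) (5 * l j z)) ^ (d : ℝ) ≤ T := by
    intro j
    calc ∑' z : u j, ediam (closedBall (z : ℂ) (5 * l j z)) ^ (d : ℝ)
        ≤ ∑' z : u j, T * ENNReal.ofReal (l j z / C) ^ (d : ℝ) := by
          refine ENNReal.tsum_le_tsum fun z => ?_
          rw [hT, ← ENNReal.mul_rpow_of_nonneg _ _ hd0'.le]
          exact ENNReal.rpow_le_rpow (hdiam j z z.2) hd0'.le
      _ = T * ∑' z : u j, ENNReal.ofReal (l j z / C) ^ (d : ℝ) := ENNReal.tsum_mul_left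
      _ ≤ T * 1 := by
          gcongr
          rw [ENNReal.tsum_eq_iSup_sum]
          refine iSup_le fun F => ?_
          have := hF j (F.map ⟨Subtype.val, Subtype.val_injective⟩) (by
            intro z hz
            simp only [Finset.coe_map, Function.Embedding.coeFn_mk, mem_image] at hz
            obtain ⟨w, -, rfl⟩ := hz
            exact w.2)
          simpa using this
      _ = T := mul_one T
  have hmeas : Measure.hausdorffMeasure (d : ℝ) E ≤ T := by
    refine (Measure.hausdorffMeasure_le_liminf_tsum (ι := fun j => u j) (d : ℝ) E (l := atTop)
      (fun j : ℕ => ENNReal.ofReal (10 * (1 / ((j : ℝ) + 1)))) ?_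
      (fun j z => closedBall (z : ℂ) (5 * l j z)) ?_ ?_).trans ?_
    · have : Tendsto (fun j : ℕ => 10 * (1 / ((j : ℝ) + 1))) atTop (𝓝 (10 * 0)) :=
        tendsto_one_div_add_atTop_nhds_zero_nat.const_mul 10
      rw [mul_zero] at this
      simpa using ENNReal.tendsto_ofReal this
    · refine Eventually.of_forall fun j z => (hdiam j z z.2).trans ?_
      rw [← ENNReal.ofReal_mul (by positivity)]
      refine ENNReal.ofReal_le_ofReal ?_
      rw [show 10 * C * (l j z / C) = 10 * l j z by field_simp]
      have := (hl j z z.2).2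
      gcongr
    · refine Eventually.of_forall fun j => ?_
      rw [iUnion_coe_set]
      exact hcov j
    · refine (liminf_le_liminf (Eventually.of_forall htsum)).trans ?_
      simp
  rw [hinf, top_le_iff] at hmeas
  exact ENNReal.rpow_ne_top_of_nonneg hd0'.le ENNReal.ofReal_ne_top hmeas

end MeromorphicDynamics

namespace MeromorphicDynamics

open Metric
open scoped NNReal

/-! ### Inverse branches at points of the spherical radial Julia set -/

variable {f : ℂ → OnePoint ℂ}

/-- The inverse of the coordinate `1 / w` at `∞`. -/
noncomputable def reciprocalInv (u : ℂ) : OnePoint ℂ := if u = 0 then ∞ else (u⁻¹ : ℂ)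

theorem reciprocal_reciprocalInv (u : ℂ) : reciprocal (reciprocalInv u) = u := by
  by_cases h : u = 0 <;> simp [reciprocalInv, h]

theorem reciprocalInv_ne_zero (u : ℂ) : reciprocalInv u ≠ ((0 : ℂ) : OnePoint ℂ) := by
  by_cases h : u = 0
  · simp [reciprocalInv, h]
  · simp only [reciprocalInv, h, if_false, ne_eq, OnePoint.coe_eq_coe]
    exact inv_ne_zero h

theorem reciprocalInv_image_ball {t : ℝ} (ht : 0 < t) :
    reciprocalInv '' ball 0 t = ((fun z : ℂ => (z : OnePoint ℂ)) '' closedBall 0 t⁻¹)ᶜ := by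
  ext w
  induction w using OnePoint.rec with
  | infty =>
    simp only [mem_compl_iff, mem_image, OnePoint.coe_ne_infty, and_false, exists_false,
      not_false_eq_true, iff_true]
    exact ⟨0, mem_ball_self ht, by simp [reciprocalInv]⟩
  | coe z =>
    have hz : (z : OnePoint ℂ) ∈ (fun z : ℂ => (z : OnePoint ℂ)) '' closedBall 0 t⁻¹ ↔
        ‖z‖ ≤ t⁻¹ := by simp
    rw [mem_compl_iff, hz, not_le]
    constructor
    · rintro ⟨u, hu, huz⟩
      have h1 := congrArg reciprocal huz
      rw [reciprocal_reciprocalInv, reciprocal_coe] at h1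
      rw [h1, mem_ball_zero_iff, norm_inv] at hu
      have hz0 : 0 < ‖z‖ := by
        rw [norm_pos_iff]
        rintro rfl
        exact reciprocalInv_ne_zero u huz
      exact inv_lt_of_inv_lt₀ hz0 hu
    · intro hzt
      have hz0 : z ≠ 0 := norm_pos_iff.1 ((inv_pos.2 ht).trans hzt)
      refine ⟨z⁻¹, ?_, by simp [reciprocalInv, hz0]⟩
      rw [mem_ball_zero_iff, norm_inv]
      exact inv_lt_of_inv_lt₀ ht hzt

theorem chordalDist_reciprocalInv_le (u v : ℂ) :
    chordalDist (reciprocalInv u) (reciprocalInv v) ≤ ‖u - v‖ := by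
  have hsymm : ∀ w : ℂ, chordalDist ∞ w = chordalDist w ∞ := fun _ => rfl
  have hinf : ∀ w : ℂ, w ≠ 0 → chordalDist ((w⁻¹ : ℂ) : OnePoint ℂ) ∞ ≤ ‖w‖ := by
    intro w hw
    have h := norm_mul_chordalDist_infty_le w⁻¹
    rw [norm_inv] at h
    have hw' : 0 < ‖w‖ := norm_pos_iff.2 hw
    rwa [inv_mul_le_iff₀ hw', mul_one] at h
  by_cases hu : u = 0 <;> by_cases hv : v = 0
  · simp [reciprocalInv, hu, hv, chordalDist]
  · simp only [reciprocalInv, hu, hv, if_true, if_false, zero_sub, norm_neg]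
    exact hsymm _ ▸ hinf v hv
  · simp only [reciprocalInv, hu, hv, if_true, if_false, sub_zero]
    exact hinf u hu
  · simp only [reciprocalInv, hu, hv, if_false]
    change ‖u⁻¹ - v⁻¹‖ / (Real.sqrt (1 + ‖u⁻¹‖ ^ 2) * Real.sqrt (1 + ‖v⁻¹‖ ^ 2)) ≤ ‖u - v‖
    have hu' : 0 < ‖u‖ := norm_pos_iff.2 hu
    have hv' : 0 < ‖v‖ := norm_pos_iff.2 hv
    have hs : ∀ w : ℂ, ‖w‖ ≤ Real.sqrt (1 + ‖w‖ ^ 2) := fun w =>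
      Real.le_sqrt_of_sq_le (by linarith)
    rw [div_le_iff₀ (mul_pos (Real.sqrt_pos.2 (by positivity)) (Real.sqrt_pos.2 (by positivity)))]
    calc ‖u⁻¹ - v⁻¹‖ = ‖u - v‖ * (‖u⁻¹‖ * ‖v⁻¹‖) := by
          rw [inv_sub_inv hu hv, norm_div, norm_mul, norm_inv, norm_inv, norm_sub_rev]
          field_simp
      _ ≤ _ := by gcongr <;> exact hs _

/-- Every point `w` of the sphere is the image of the centre of a plane disk of small spherical
size under the inverse `e` of a holomorphic coordinate `κ`: the identity if `w` is finite, and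
the reciprocal if `w = ∞`. -/
theorem exists_chart (w : OnePoint ℂ) {δ : ℝ} (hδ : 0 < δ) :
    ∃ (e : ℂ → OnePoint ℂ) (κ : OnePoint ℂ → ℂ) (a : ℂ) (ρ : ℝ), 0 < ρ ∧
      (∀ u, κ (e u) = u) ∧ (∀ t > 0, IsOpen (e '' ball a t)) ∧ e a = w ∧
      (∀ v ∈ e '' ball a ρ, e '' ball a ρ ⊆ sphDisk v δ) ∧
      ∀ (h : ℂ → OnePoint ℂ) (x : ℂ), HolomorphicAt h x → h x ∈ e '' ball a ρ →
        AnalyticAt ℂ (κ ∘ h) x := by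
  obtain ⟨t, ht, hts⟩ := exists_chordalDist_lt_imp_sphDist_lt hδ
  have hdist : ∀ {a u v : ℂ}, u ∈ ball a (t / 2) → v ∈ ball a (t / 2) → ‖u - v‖ < t := by
    intro a u v hu hv
    rw [← dist_eq_norm]
    rw [mem_ball] at hu hv
    linarith [dist_triangle_right u v a]
  induction w using OnePoint.rec with
  | infty =>
    refine ⟨reciprocalInv, reciprocal, 0, t / 2, half_pos ht, reciprocal_reciprocalInv,
      fun s hs => ?_, by simp [reciprocalInv], ?_, fun h x hh hx => ?_⟩
    · rw [reciprocalInv_image_ball hs]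
      exact OnePoint.isOpen_compl_image_coe.2 ⟨isClosed_closedBall, isCompact_closedBall _ _⟩
    · rintro _ ⟨v, hv, rfl⟩ _ ⟨u, hu, rfl⟩
      exact hts _ _ ((chordalDist_reciprocalInv_le u v).trans_lt (hdist hu hv))
    · obtain ⟨u, -, hu⟩ := hx
      exact hh.analyticAt_reciprocal_of_ne_zero (hu ▸ reciprocalInv_ne_zero u)
  | coe z =>
    refine ⟨fun u => u, finitePart, z, t / 2, half_pos ht, fun _ => rfl, fun s _ =>
      OnePoint.isOpenEmbedding_coe.isOpenMap _ isOpen_ball, rfl, ?_, fun h x hh hx => ?_⟩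
    · rintro _ ⟨v, hv, rfl⟩ _ ⟨u, hu, rfl⟩
      exact hts _ _ ((chordalDist_coe_le u v).trans_lt (hdist hu hv))
    · obtain ⟨u, -, hu⟩ := hx
      exact hh.analyticAt_finitePart (hu ▸ OnePoint.coe_ne_infty u)

/-- A conformal pull-back of a spherical disk yields a univalent inverse branch of the iterate, in
the coordinate of `exists_chart`. -/
theorem PullsBackConformally.exists_inverseBranch (hf : ∀ z, HolomorphicAt f z) {n : ℕ} {z : ℂ}
    {D : Set (OnePoint ℂ)} (hpull : PullsBackConformally f n z D) {e : ℂ → OnePoint ℂ}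
    {κ : OnePoint ℂ → ℂ} {a : ℂ} {ρ : ℝ} (hκ : ∀ u, κ (e u) = u)
    (hopen : IsOpen (e '' ball a ρ)) (hD : e '' ball a ρ ⊆ D)
    (hhol : ∀ (h : ℂ → OnePoint ℂ) (x : ℂ), HolomorphicAt h x → h x ∈ e '' ball a ρ →
        AnalyticAt ℂ (κ ∘ h) x) (hz : iter f n z ∈ e '' ball a ρ) :
    ∃ (W : Set ℂ) (ψ : ℂ → ℂ), IsOpen W ∧ z ∈ W ∧ W ⊆ iterDomain f n ∧ InjOn (iter f n) W ∧
      DifferentiableOn ℂ ψ (ball a ρ) ∧ InjOn ψ (ball a ρ) ∧ MapsTo ψ (ball a ρ) W ∧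
      (∀ u ∈ ball a ρ, iter f n (ψ u) = e u) ∧ ψ (κ (iter f n z)) = z := by
  obtain ⟨hzP, hbij⟩ := hpull
  set U := connectedComponentIn (iterPreimage f n D) z with hU
  set B := e '' ball a ρ with hB
  have heκ : ∀ v ∈ B, e (κ v) = v := by
    rintro _ ⟨u, -, rfl⟩
    rw [hκ]
  set W := U ∩ iterPreimage f n B with hW
  have hWo : IsOpen W := by
    rw [Metric.isOpen_iff]
    rintro x ⟨hxU, hxB⟩
    obtain ⟨r, hr, hrB⟩ := Metric.isOpen_iff.1 (isOpen_iterPreimage hf n hopen) x hxB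
    refine ⟨r, hr, fun y hy => ⟨?_, hrB hy⟩⟩
    rw [hU, connectedComponentIn_eq hxU]
    exact (convex_ball x r).isPreconnected.subset_connectedComponentIn (mem_ball_self hr)
      (show ball x r ⊆ iterPreimage f n D from fun y hy => ⟨(hrB hy).1, hD (hrB hy).2⟩) hy
  have hinj : InjOn (iter f n) W := hbij.injOn.mono inter_subset_left
  set G := κ ∘ iter f n with hG
  have hGd : DifferentiableOn ℂ G W := fun x hx =>
    (hhol _ x (holomorphicAt_iter hf n hx.2.1) hx.2.2).differentiableAt.differentiableWithinAt
  have hGi : InjOn G W := fun x hx y hy hxy => hinj hx hy (by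
    rw [← heκ _ hx.2.2, ← heκ _ hy.2.2]
    exact congrArg e hxy)
  have hinv : LeftInvOn (Function.invFunOn G W) G W := hGi.leftInvOn_invFunOn
  set ψ := Function.invFunOn G W
  have hpre : ∀ u ∈ ball a ρ, ∃ x ∈ W, iter f n x = e u ∧ G x = u := by
    intro u hu
    have heu : e u ∈ B := mem_image_of_mem e hu
    obtain ⟨x, hx, hxu⟩ := hbij.surjOn (hD heu)
    exact ⟨x, ⟨hx, (connectedComponentIn_subset _ _ hx).1, by rw [hxu]; exact heu⟩, hxu,
      by simp [hG, hxu, hκ]⟩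
  have hzW : z ∈ W := ⟨mem_connectedComponentIn hzP, hzP.1, hz⟩
  refine ⟨W, ψ, hWo, hzW, fun x hx => hx.2.1, hinj, fun u hu => ?_, fun u hu v hv huv => ?_,
    fun u hu => ?_, fun u hu => ?_, hinv hzW⟩
  · obtain ⟨x, hx, -, rfl⟩ := hpre u hu
    exact (differentiableAt_of_leftInvOn hWo hGd hinv hx).differentiableWithinAt
  · obtain ⟨x, hx, -, rfl⟩ := hpre u hu
    obtain ⟨y, hy, -, rfl⟩ := hpre v hv
    rw [hinv hx, hinv hy] at huv
    rw [huv]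
  · obtain ⟨x, hx, -, rfl⟩ := hpre u hu
    rwa [hinv hx]
  · obtain ⟨x, hx, hxu, rfl⟩ := hpre u hu
    rw [hinv hx, hxu]

/-- Preimages under an iterate, away from its critical points, do not raise the dimension. -/
theorem dimH_preimage_iter_le (hf : ∀ z, HolomorphicAt f z) (m : ℕ) (E : Set ℂ) :
    dimH {z | (∃ v ∈ E, iter f m z = (v : OnePoint ℂ)) ∧ iterDeriv f m z ≠ 0} ≤ dimH E := by
  set S := {z | (∃ v ∈ E, iter f m z = (v : OnePoint ℂ)) ∧ iterDeriv f m z ≠ 0} with hS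
  by_contra! hlt
  obtain ⟨x, ⟨⟨v, hv, hxv⟩, hx0⟩, hx⟩ := exists_mem_nhdsWithin_lt_dimH_of_lt_dimH hlt
  set G := finitePart ∘ iter f m with hG
  obtain ⟨r, hr, hlip⟩ := exists_ball_biLipschitz
    (analyticAt_finitePart_iter hf (hxv ▸ OnePoint.coe_ne_infty v)) hx0
  set t := S ∩ ball x r with ht
  have hpos : 0 < ‖deriv G x‖ := norm_pos_iff.2 hx0
  have hlow : ∀ y ∈ t, ∀ y' ∈ t, ‖deriv G x‖ / 2 * dist y y' ≤ dist (G y) (G y') :=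
    fun y hy y' hy' => (hlip y hy.2 y' hy'.2).1
  have hinj : InjOn G t := fun y hy y' hy' hyy => by
    have := hlow y hy y' hy'
    rw [hyy, dist_self] at this
    exact dist_le_zero.1 (nonpos_of_mul_nonpos_right this (half_pos hpos))
  have hinv : LeftInvOn (Function.invFunOn G t) G t := hinj.leftInvOn_invFunOn
  have himg : Function.invFunOn G t '' (G '' t) = t := hinv.image_image
  have hL : LipschitzOnWith (2 / ‖deriv G x‖).toNNReal (Function.invFunOn G t) (G '' t) := by
    refine LipschitzOnWith.of_dist_le_mul ?_
    rintro _ ⟨y, hy, rfl⟩ _ ⟨y', hy', rfl⟩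
    rw [hinv hy, hinv hy', Real.coe_toNNReal _ (by positivity), div_mul_eq_mul_div,
      le_div_iff₀ hpos]
    linarith [hlow y hy y' hy']
  have h1 := hx t (inter_mem self_mem_nhdsWithin (nhdsWithin_le_nhds (ball_mem_nhds x hr)))
  have h2 : G '' t ⊆ E := by
    rintro _ ⟨y, ⟨⟨⟨v', hv', hyv⟩, -⟩, -⟩, rfl⟩
    simpa [hG, hyv] using hv'
  have h3 := hL.dimH_image_le
  rw [himg] at h3
  exact absurd (h3.trans (dimH_mono h2)) (not_le.2 h1)

theorem exists_denseSeq_ball_subset {v : ℂ} {O : Set ℂ} (hO : O ∈ 𝓝 v) :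
    ∃ k j : ℕ, v ∈ ball (TopologicalSpace.denseSeq ℂ k) (1 / ((j : ℝ) + 1)) ∧
      ball (TopologicalSpace.denseSeq ℂ k) (1 / ((j : ℝ) + 1)) ⊆ O := by
  obtain ⟨ε, hε, hεO⟩ := Metric.mem_nhds_iff.1 hO
  obtain ⟨j, hj⟩ := exists_nat_one_div_lt (half_pos hε)
  obtain ⟨k, hk⟩ := (TopologicalSpace.denseRange_denseSeq ℂ).exists_dist_lt v
    (Nat.one_div_pos_of_nat (n := j) (α := ℝ))
  refine ⟨k, j, hk, (ball_subset_ball' ?_).trans hεO⟩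
  rw [dist_comm]
  linarith

/-- Each point of the spherical radial Julia set is mapped, by some iterate, into one of countably
many sets `branchSet`. A cluster point of the orbit provides the coordinate in which infinitely many
inverse branches are defined on a common disk; the branches shrink, as otherwise all iterates would
be univalent on a disk about `z`, which is impossible in the Julia set. -/
theorem IsTranscendentalMeromorphic.exists_iter_mem_branchSet (hf : IsTranscendentalMeromorphic f)
    {z : ℂ} (hz : z ∈ sphRadialJuliaSet f) : ∃ k j c m : ℕ,
      (∃ v ∈ branchSet f (TopologicalSpace.denseSeq ℂ k) (1 / ((j : ℝ) + 1)) ((c : ℝ) + 1) ∩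
        ball (TopologicalSpace.denseSeq ℂ k) (1 / ((j : ℝ) + 1)),
        iter f m z = (v : OnePoint ℂ)) ∧ iterDeriv f m z ≠ 0 := by
  have hhol := hf.1.holomorphicAt
  obtain ⟨hzJ, δ, hδ, n, -, hunb, hpull⟩ := hz
  have hQ : ∃ᶠ m in atTop, PullsBackConformally f m z (sphDisk (iter f m z) δ) := by
    rw [frequently_atTop]
    intro b
    by_contra! hcon
    refine hunb ⟨b, ?_⟩
    rintro _ ⟨j, rfl⟩
    by_contra! hlt
    exact hcon (n j) hlt.le (hpull j)
  have hfin : ∀ k, iter f k z ≠ ∞ := by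
    intro k
    obtain ⟨m, hkm, hm⟩ := frequently_atTop.1 hQ (k + 1)
    exact hm.1.1 k hkm
  -- A cluster point `w` of the times with a conformal pull-back.
  obtain ⟨w, hw⟩ : ∃ w : OnePoint ℂ, ∀ V ∈ 𝓝 w, ∃ᶠ m in atTop,
      PullsBackConformally f m z (sphDisk (iter f m z) δ) ∧ iter f m z ∈ V := by
    set l : Filter ℕ := atTop ⊓ 𝓟 {m | PullsBackConformally f m z (sphDisk (iter f m z) δ)}
    have hl : NeBot l := frequently_mem_iff_neBot.1 hQ
    obtain ⟨w, hw⟩ := exists_clusterPt_of_compactSpace (map (fun m => iter f m z) l)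
    refine ⟨w, fun V hV => ?_⟩
    have h1 : ∃ᶠ m in l, iter f m z ∈ V := frequently_map.1 (clusterPt_iff_frequently.1 hw V hV)
    exact frequently_inf_principal.1 h1
  obtain ⟨e, κ, a, ρ, hρ, hκ, hopen, hea, hdisk, hchart⟩ := exists_chart w hδ
  have hρ8 : ball a (ρ / 8) ⊆ ball a ρ := ball_subset_ball (by linarith)
  have heκ : ∀ v ∈ e '' ball a (ρ / 8), κ v ∈ ball a (ρ / 8) ∧ e (κ v) = v := by
    rintro _ ⟨u, hu, rfl⟩
    rw [hκ]
    exact ⟨hu, rfl⟩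
  set P : ℕ → Prop := fun m => PullsBackConformally f m z (sphDisk (iter f m z) δ) ∧
    iter f m z ∈ e '' ball a (ρ / 8) with hP
  have hPf : ∃ᶠ m in atTop, P m := hw _ ((hopen (ρ / 8) (by positivity)).mem_nhds
    ⟨a, mem_ball_self (by positivity), hea⟩)
  have hbranch : ∀ m, P m → ∃ (W : Set ℂ) (ψ : ℂ → ℂ), IsOpen W ∧ z ∈ W ∧ W ⊆ iterDomain f m ∧
      InjOn (iter f m) W ∧ DifferentiableOn ℂ ψ (ball a ρ) ∧ InjOn ψ (ball a ρ) ∧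
      MapsTo ψ (ball a ρ) W ∧ (∀ u ∈ ball a ρ, iter f m (ψ u) = e u) ∧ ψ (κ (iter f m z)) = z :=
    fun m hm => hm.1.exists_inverseBranch hhol hκ (hopen ρ hρ)
      (hdisk _ (image_mono hρ8 hm.2)) hchart (image_mono hρ8 hm.2)
  choose! W ψ hWo hzW hWdom hWinj hψd hψi hψW hψe hψz using hbranch
  have hu : ∀ m, P m → κ (iter f m z) ∈ ball a (ρ / 8) := fun m hm => (heκ _ hm.2).1
  have hD1 := one_le_distortionConst
  have hD : 0 < distortionConst := one_pos.trans_le hD1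
  have hK := koebeConst_pos
  have hshrink : ∀ ε > 0, ∀ᶠ m in atTop, P m → ‖deriv (ψ m) a‖ < ε := by
    intro ε hε
    by_contra hcon
    have hcon' : ∃ᶠ m in atTop, P m ∧ ε ≤ ‖deriv (ψ m) a‖ := by
      refine (not_eventually.1 hcon).mono fun m hm => ?_
      push Not at hm
      exact hm
    set r := ρ / 8 * (ε / distortionConst) / koebeConst with hr
    have hr0 : 0 < r := by positivity
    have hsub : ∀ m, P m → ε ≤ ‖deriv (ψ m) a‖ → ball z r ⊆ W m := by
      intro m hm hεm
      have hum := hu m hm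
      have hub : ball (κ (iter f m z)) (ρ / 8) ⊆ ball a ρ := ball_subset_ball' (by
        rw [mem_ball] at hum
        linarith)
      have h1 := ball_subset_image_of_injOn (by positivity : 0 < ρ / 8) ((hψd m hm).mono hub)
        ((hψi m hm).mono hub)
      rw [hψz m hm] at h1
      have h2 : ε / distortionConst ≤ ‖deriv (ψ m) (κ (iter f m z))‖ := by
        rw [div_le_iff₀ hD, mul_comm]
        exact hεm.trans (norm_deriv_center_le_of_injOn (hψd m hm) (hψi m hm)
          (ball_subset_ball (by linarith) hum))
      refine (ball_subset_ball ?_).trans (h1.trans ?_)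
      · rw [hr]
        gcongr
      · exact (image_mono hub).trans (hψW m hm).image_subset
    have hk : ∀ k, ∃ m > k, P m ∧ ball z r ⊆ W m := fun k => by
      obtain ⟨m, hkm, hm, hεm⟩ := frequently_atTop.1 hcon' (k + 1)
      exact ⟨m, hkm, hm, hsub m hm hεm⟩
    refine hzJ (hf.mem_fatouSet_of_injOn hr0 (fun k x hx => ?_) fun k x hx y hy hxy => ?_)
    · obtain ⟨m, hkm, hm, hmW⟩ := hk k
      exact hWdom m hm (hmW hx) k hkm
    · obtain ⟨m, hkm, hm, hmW⟩ := hk k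
      exact hWinj m hm (hmW hx) (hmW hy) (iter_eq_of_le hkm.le hxy)
  obtain ⟨m₀, hm₀⟩ := hPf.exists
  obtain ⟨v, hv⟩ := OnePoint.ne_infty_iff_exists.1 (hfin m₀)
  -- `iter f m₀` is bi-Lipschitz near `z`.
  set G := finitePart ∘ iter f m₀ with hG
  have hGz : G z = v := by simp [hG, ← hv]
  have hGan : AnalyticAt ℂ G z := analyticAt_finitePart_iter hhol (hfin m₀)
  have hG0 : deriv G z ≠ 0 := by
    have ho : IsOpen (W m₀ ∩ {x | iter f m₀ x ≠ ∞}) :=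
      (hWo m₀ hm₀).inter (isOpen_iter_ne_infty hhol m₀)
    refine deriv_ne_zero_of_injOn ho (fun x hx =>
      (analyticAt_finitePart_iter hhol hx.2).differentiableAt.differentiableWithinAt)
      (fun x hx y hy hxy => hWinj m₀ hm₀ hx.1 hy.1 ?_) ⟨hzW m₀ hm₀, hfin m₀⟩
    rw [iter_eq_coe hx.2, iter_eq_coe hy.2]
    exact congrArg _ hxy
  obtain ⟨r₁, hr₁, hGlip⟩ := exists_ball_biLipschitz hGan hG0
  obtain ⟨r₂, hr₂, hGfin⟩ := Metric.isOpen_iff.1 (isOpen_iter_ne_infty hhol m₀) z (hfin m₀)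
  set μ := ‖deriv G z‖ with hμ
  have hμ0 : 0 < μ := norm_pos_iff.2 hG0
  -- The coordinate is bi-Lipschitz near `v`.
  set χ : ℂ → ℂ := fun x => κ (x : OnePoint ℂ) with hχ
  have hcoe : ∀ x : ℂ, HolomorphicAt (fun x : ℂ => (x : OnePoint ℂ)) x := fun x =>
    holomorphicAt_iter hhol 0 (by simp [iterDomain])
  set O : Set ℂ := (fun x : ℂ => (x : OnePoint ℂ)) ⁻¹' (e '' ball a (ρ / 8)) with hO
  have hOo : IsOpen O := (hopen (ρ / 8) (by positivity)).preimage OnePoint.continuous_coe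
  have hvO : v ∈ O := by
    change (v : OnePoint ℂ) ∈ e '' ball a (ρ / 8)
    rw [hv]
    exact hm₀.2
  have hχan : ∀ x ∈ O, AnalyticAt ℂ χ x := fun x hx =>
    hchart (fun x : ℂ => (x : OnePoint ℂ)) x (hcoe x) (image_mono hρ8 hx)
  have hχ0 : deriv χ v ≠ 0 := by
    refine deriv_ne_zero_of_injOn hOo (fun x hx =>
      (hχan x hx).differentiableAt.differentiableWithinAt) (fun x hx y hy hxy => ?_) hvO
    apply OnePoint.coe_injective
    exact ((heκ _ hx).2.symm.trans (congrArg e hxy)).trans (heκ _ hy).2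
  obtain ⟨r₃, hr₃, hχlip⟩ := exists_ball_biLipschitz (hχan v hvO) hχ0
  set A := ‖deriv χ v‖ with hA
  have hA0 : 0 < A := norm_pos_iff.2 hχ0
  obtain ⟨k, j, hvb, hbO⟩ := exists_denseSeq_ball_subset
    (inter_mem (hOo.mem_nhds hvO) (ball_mem_nhds v hr₃))
  set b := TopologicalSpace.denseSeq ℂ k
  set s : ℝ := 1 / ((j : ℝ) + 1)
  set B := μ * distortionConst * ρ with hB
  have hB0 : 0 < B := by positivity
  obtain ⟨c, hc⟩ := exists_nat_ge (max (4 * μ * distortionConst * A / B)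
    (4 * (koebeConst * distortionConst) * B / (μ * A)))
  refine ⟨k, j, c, m₀, ⟨v, ⟨fun ε hε => ?_, hvb⟩, hv.symm⟩, hG0⟩
  set ε' := min (ε / B) (min r₁ r₂ / (distortionConst * ρ)) with hε'
  have hε'0 : 0 < ε' := by positivity
  obtain ⟨m, ⟨hm, hmε⟩, hmm⟩ := ((hPf.and_eventually (hshrink ε' hε'0)).and_eventually
    (eventually_gt_atTop m₀)).exists
  specialize hmε hm
  set lam := ‖deriv (ψ m) a‖ with hlam
  have hlam0 : 0 < lam := norm_pos_iff.2
    (deriv_ne_zero_of_injOn isOpen_ball (hψd m hm) (hψi m hm) (mem_ball_self hρ))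
  have hχb : ∀ x ∈ ball b s, χ x ∈ ball a (ρ / 8) := fun x hx => (heκ _ (hbO hx).1).1
  have hup : ∀ u ∈ ball a (ρ / 8), ∀ u' ∈ ball a (ρ / 8),
      dist (ψ m u) (ψ m u') ≤ distortionConst * lam * dist u u' := fun u hu u' hu' =>
    dist_le_of_injOn (hψd m hm) (hψi m hm) (ball_subset_ball (by linarith) hu)
      (ball_subset_ball (by linarith) hu')
  have hdown : ∀ u ∈ ball a (ρ / 8), ∀ u' ∈ ball a (ρ / 8),
      lam * dist u u' ≤ koebeConst * distortionConst * dist (ψ m u) (ψ m u') := fun u hu u' hu' =>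
    le_dist_of_injOn (hψd m hm) (hψi m hm) (ball_subset_ball (by linarith) hu)
      (ball_subset_ball (by linarith) hu')
  have hψz' : ∀ u ∈ ball a (ρ / 8), dist (ψ m u) z ≤ distortionConst * lam * (ρ / 4) := by
    intro u hum
    have h1 := hup u hum _ (hu m hm)
    rw [hψz m hm] at h1
    refine h1.trans ?_
    gcongr
    have h2 := mem_ball.1 hum
    have h3 := mem_ball.1 (hu m hm)
    linarith [dist_triangle_right u (κ (iter f m z)) a]
  have hnear : ∀ u ∈ ball a (ρ / 8), ψ m u ∈ ball z r₁ ∧ ψ m u ∈ ball z r₂ := by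
    intro u hum
    have h1 := hψz' u hum
    have h2 : distortionConst * ρ * lam < min r₁ r₂ := by
      have := hmε.trans_le (min_le_right _ _)
      rwa [lt_div_iff₀ (by positivity), mul_comm] at this
    have h3 : distortionConst * lam * (ρ / 4) ≤ distortionConst * ρ * lam := by
      nlinarith [mul_pos (mul_pos hD hρ) hlam0]
    exact ⟨mem_ball.2 (by linarith [min_le_left r₁ r₂]),
      mem_ball.2 (by linarith [min_le_right r₁ r₂])⟩
  have hzball : z ∈ ball z r₁ := mem_ball_self hr₁
  refine ⟨m - m₀, by omega, fun x => G (ψ m (χ x)), B * lam, by positivity, ?_, ?_,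
    fun x hx => ?_, fun x hx y hy => ?_⟩
  · have := hmε.trans_le (min_le_left _ _)
    rwa [lt_div_iff₀ hB0, mul_comm] at this
  · intro x hx
    have hχx := hχb x hx
    refine DifferentiableAt.differentiableWithinAt ?_
    exact DifferentiableAt.comp (g := G) (f := fun x => ψ m (χ x)) x
      (analyticAt_finitePart_iter hhol (hGfin (hnear _ hχx).2)).differentiableAt
      (((hψd m hm).differentiableAt (isOpen_ball.mem_nhds (hρ8 hχx))).comp x
          (hχan x (hbO hx).1).differentiableAt)
  · have hχx := hχb x hx
    have hval : iter f m₀ (ψ m (χ x)) = (G (ψ m (χ x)) : OnePoint ℂ) :=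
      iter_eq_coe (hGfin (hnear _ hχx).2)
    have hmsum : m₀ + (m - m₀) = m := by omega
    refine ⟨mem_iterDomain_of_add hval (hmsum.symm ▸ hWdom m hm (hψW m hm (hρ8 hχx))), ?_, ?_⟩
    · rw [← iter_add_of_eq hval, hmsum, hψe m hm _ (hρ8 hχx)]
      exact (heκ _ (hbO hx).1).2
    · rw [← hGz]
      calc dist (G (ψ m (χ x))) (G z) ≤ 2 * μ * dist (ψ m (χ x)) z :=
            (hGlip _ (hnear _ hχx).1 _ hzball).2
        _ ≤ 2 * μ * (distortionConst * lam * (ρ / 4)) := by gcongr; exact hψz' _ hχx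
        _ = B * lam / 2 := by rw [hB]; ring
        _ < B * lam := half_lt_self (by positivity)
  · have hχx := hχb x hx
    have hχy := hχb y hy
    have h1 := hGlip _ (hnear _ hχx).1 _ (hnear _ hχy).1
    have h2 := hχlip x (hbO hx).2 y (hbO hy).2
    have hc1 : 4 * μ * distortionConst * A / B ≤ (c : ℝ) + 1 :=
      ((le_max_left _ _).trans hc).trans (by linarith)
    have hc2 : 4 * (koebeConst * distortionConst) * B / (μ * A) ≤ (c : ℝ) + 1 :=
      ((le_max_right _ _).trans hc).trans (by linarith)
    constructor
    · have h3 : lam * (A / 2 * dist x y) ≤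
          koebeConst * distortionConst * dist (ψ m (χ x)) (ψ m (χ y)) :=
        (mul_le_mul_of_nonneg_left h2.1 hlam0.le).trans (hdown _ hχx _ hχy)
      calc B * lam * dist x y = 2 * B / A * (lam * (A / 2 * dist x y)) := by field_simp
        _ ≤ 2 * B / A * (koebeConst * distortionConst * dist (ψ m (χ x)) (ψ m (χ y))) := by gcongr
        _ = 4 * (koebeConst * distortionConst) * B / (μ * A) *
              (μ / 2 * dist (ψ m (χ x)) (ψ m (χ y))) := by field_simp; ring
        _ ≤ ((c : ℝ) + 1) * dist (G (ψ m (χ x))) (G (ψ m (χ y))) := by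
            gcongr
            exact h1.1
    · calc dist (G (ψ m (χ x))) (G (ψ m (χ y))) ≤ 2 * μ * dist (ψ m (χ x)) (ψ m (χ y)) := h1.2
        _ ≤ 2 * μ * (distortionConst * lam * dist (χ x) (χ y)) := by
            gcongr
            exact hup _ hχx _ hχy
        _ ≤ 2 * μ * (distortionConst * lam * (2 * A * dist x y)) := by
            gcongr
            exact h2.2
        _ = 4 * μ * distortionConst * A / B * (B * lam) * dist x y := by field_simp; ring
        _ ≤ ((c : ℝ) + 1) * (B * lam) * dist x y := by gcongr

theorem IsTranscendentalMeromorphic.dimH_sphRadialJuliaSet_le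
    (hf : IsTranscendentalMeromorphic f) : dimH (sphRadialJuliaSet f) ≤ hyperbolicDim f := by
  have hhol := hf.1.holomorphicAt
  have hsub : sphRadialJuliaSet f ⊆ ⋃ p : ℕ × ℕ × ℕ × ℕ,
      {z | (∃ v ∈ branchSet f (TopologicalSpace.denseSeq ℂ p.1) (1 / ((p.2.1 : ℝ) + 1))
        ((p.2.2.1 : ℝ) + 1) ∩ ball (TopologicalSpace.denseSeq ℂ p.1) (1 / ((p.2.1 : ℝ) + 1)),
        iter f p.2.2.2 z = (v : OnePoint ℂ)) ∧ iterDeriv f p.2.2.2 z ≠ 0} := by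
    intro z hz
    obtain ⟨k, j, c, m, h⟩ := hf.exists_iter_mem_branchSet hz
    exact mem_iUnion.2 ⟨(k, j, c, m), h⟩
  refine (dimH_mono hsub).trans ?_
  rw [dimH_iUnion]
  exact iSup_le fun p => (dimH_preimage_iter_le hhol _ _).trans
    (dimH_branchSet_inter_ball_le hhol _ _ (by simp))

end MeromorphicDynamics

theorem mainTheorem3 (f : ℂ → OnePoint ℂ)
    (hf : MeromorphicDynamics.IsTranscendentalMeromorphic f) :
    MeromorphicDynamics.hyperbolicDim f = dimH (MeromorphicDynamics.radialJuliaSet f) ∧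
      dimH (MeromorphicDynamics.radialJuliaSet f) =
        dimH (MeromorphicDynamics.sphRadialJuliaSet f) := by
  have hhol := hf.1.holomorphicAt
  have h1 : MeromorphicDynamics.hyperbolicDim f ≤
      dimH (MeromorphicDynamics.radialJuliaSet f) :=
    iSup₂_le fun K hK => dimH_mono (hK.subset_radialJuliaSet hhol)
  have h2 := dimH_mono (MeromorphicDynamics.radialJuliaSet_subset_sphRadialJuliaSet hhol)
  have h3 := hf.dimH_sphRadialJuliaSet_le
  exact ⟨h1.antisymm (h2.trans h3), h2.antisymm (h3.trans h1)⟩
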